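/- A weighted voting game on agents $\{1,\dots,n\}$ has weights $w_1\le\dots\le w_n$ and a quota $q$. A coalition $S$ has value $v(S)=1$ if $\sum_{i\in S}w_i\ge q$ and $v(S)=0$ otherwise. The Shapley value of agent $i$ is $\varphi_i=\frac1{n!}\sum_{\sigma}\bigl(v(P_i(\sigma)\cup\{i\})-v(P_i(\sigma))\bigr)$, where $\sigma$ ranges over the permutations of $\{1,\dots,n\}$ and $P_i(\sigma)=\{j:\sigma(j)<\sigma(i)\}$. In the uniform balls and bins process, $m$ balls are thrown independently and uniformly at random into $n$ bins, and $w_1\le\dots\le w_n$ are the numbers of balls in the bins, sorted in non-decreasing order. **Theorem.** Let $\ell=\ell(n)$ and $m=m(n)$ be sequences of non-negative integers such that $\ell(n)\ge 1$ for all large $n$, $\ell(n)=o(\log n)$ and $m(n)=\Omega(n^3\log n)$, as $n\to\infty$. Let the weights $w_1\le\dots\le w_n$ be drawn from the uniform balls and bins process with $m$ balls and $n$ bins, and let the quota be $q=\ell\cdot\frac mn$. Then the expected Shapley value of the lightest agent satisfies $$\mathbb E[\varphi_1]=\frac1{2n}+o\!\left(\frac1n\right)\qquad(n\to\infty).$$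 -/

import Mathlib

open Filter Asymptotics MeasureTheory

namespace VotingGame

/-- The characteristic function of the weighted voting game with weights `w` and quota `q`:
a coalition has value `1` if its total weight is at least `q`, and `0` otherwise. -/
noncomputable def value {n : ℕ} (w : Fin n → ℝ) (q : ℝ) (S : Finset (Fin n)) : ℝ :=
  open Classical in if q ≤ ∑ i ∈ S, w i then 1 else 0

/-- The set of predecessors of agent `i` in the permutation `σ`. -/
def predecessors {n : ℕ} (σ : Equiv.Perm (Fin n)) (i : Fin n) : Finset (Fin n) :=
  Finset.univ.filter fun j => σ j < σ i

/-- The marginal contribution of agent `i` to the coalition `S`. -/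
noncomputable def marginal {n : ℕ} (w : Fin n → ℝ) (q : ℝ) (i : Fin n)
    (S : Finset (Fin n)) : ℝ :=
  value w q (insert i S) - value w q S

/-- The Shapley value (Shapley–Shubik power index) of agent `i`. -/
noncomputable def shapley {n : ℕ} (w : Fin n → ℝ) (q : ℝ) (i : Fin n) : ℝ :=
  (1 / (n.factorial : ℝ)) * ∑ σ : Equiv.Perm (Fin n), marginal w q i (predecessors σ i)

/-- The law of `m` balls thrown independently and uniformly at random into `n` bins:
`ω b` is the bin that receives ball `b`. -/
noncomputable def ballsAndBins (m n : ℕ) : Measure (Fin m → Fin n) :=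
  Measure.pi fun _ : Fin m => ProbabilityTheory.uniformOn (Set.univ : Set (Fin n))

/-- The number of balls in bin `i`. -/
def load {m n : ℕ} (ω : Fin m → Fin n) (i : Fin n) : ℕ :=
  (Finset.univ.filter fun b => ω b = i).card

/-- The weights of the agents: the loads of the bins, sorted in non-decreasing order. -/
def sortedWeight {m n : ℕ} (ω : Fin m → Fin n) (i : Fin n) : ℝ :=
  (load ω (Tuple.sort (load ω) i) : ℝ)

/-- The expected Shapley value of the lightest of `n` agents (index `0` after sorting), for
weights from the uniform balls and bins process with `m` balls and quota `q`.
The value for `n = 0`, when there is no agent, is set to `0`. -/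
noncomputable def expectedMinShapley (n m : ℕ) (q : ℝ) : ℝ :=
  if hn : 0 < n then ∫ ω, shapley (sortedWeight ω) q (⟨0, hn⟩ : Fin n) ∂(ballsAndBins m n)
  else 0

end VotingGame

set_option linter.unusedSectionVars false

namespace VotingGame

/-! Write `w` for the load of the lightest bin. Since `m` is at least of order `n ^ 3 * log n` and
`ℓ = o(log n)`, Hoeffding and a union bound put every load within `(m / n) / (ℓ + 1)` of `m / n`,
outside an event of probability `o(1 / n)`. Then fewer than `ℓ` agents always lose and more than `ℓ`
always win, so an agent can be pivotal only with `ℓ` or `ℓ - 1` predecessors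
(`marginal_predecessors_eq`). An agent occupies a given position with probability `1 / n`, and
conditioning on this changes the law of its predecessors by only `O(ℓ / n)`. Hence `n * φ₁` is, up
to `o(1)`, the chance that a random `ℓ`-set weighs less than `q` plus the chance that a random `(ℓ -
1)`-set weighs at least `q - w`.

The weight of a fixed `ℓ`-set is binomial with mean exactly `q`, so by the central limit theorem
(`tendsto_measureReal_hits`) the first chance tends to `1 / 2`.

The second vanishes because the lightest bin is unusually light. Choose `k` with `ℓ ≪ k ≪ log n`.
With high probability `w ≤ m / n - a`, where `a = √(k * m / n)`
(`tendsto_measureReal_forall_load_gt`). An `(ℓ - 1)`-set must then exceed its mean by `a`, which by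
Chebyshev has probability at most `ℓ / k`. The lightness of `w` combines a lower bound of at least
`n ^ (-1 / 2) / 2` for one bin to be that light (`lowerTail_ge`) with negative dependence of the
loads (`integral_prod_load_le`): all `n` bins avoid it with probability at most `exp (-√n / 2)`. -/

/-- The first `k` agents in the order given by `σ`. -/
def initial {n : ℕ} (σ : Equiv.Perm (Fin n)) (k : ℕ) : Finset (Fin n) :=
  Finset.univ.filter fun j => (σ j : ℕ) < k

/-- The average of a function over all permutations of `Fin n`. -/
noncomputable def permAvg {n : ℕ} (f : Equiv.Perm (Fin n) → ℝ) : ℝ :=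
  (1 / (n.factorial : ℝ)) * ∑ σ, f σ

/-! ### Averages over random orders. -/

section permAvg

variable {n : ℕ}

@[simp]
lemma mem_initial {σ : Equiv.Perm (Fin n)} {k : ℕ} {j : Fin n} :
    j ∈ initial σ k ↔ (σ j : ℕ) < k := by
  simp [initial]

@[simp]
lemma mem_predecessors {σ : Equiv.Perm (Fin n)} {i j : Fin n} :
    j ∈ predecessors σ i ↔ σ j < σ i := by
  simp [predecessors]

lemma card_initial (σ : Equiv.Perm (Fin n)) {k : ℕ} (hk : k ≤ n) : (initial σ k).card = k := by
  have : (initial σ k).card = (Finset.univ.filter fun j : Fin n => (j : ℕ) < k).card := by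
    refine Finset.card_bij (fun j _ => σ j) ?_ ?_ ?_
    · intro a ha
      simpa [initial] using ha
    · intro a _ b _ h
      exact σ.injective h
    · intro b hb
      exact ⟨σ.symm b, by simpa [initial] using hb, by simp⟩
  rw [this, Fin.card_filter_val_lt]
  simpa using hk

lemma permAvg_mono {f g : Equiv.Perm (Fin n) → ℝ} (h : ∀ σ, f σ ≤ g σ) :
    permAvg f ≤ permAvg g :=
  mul_le_mul_of_nonneg_left (Finset.sum_le_sum fun σ _ => h σ) (by positivity)

lemma permAvg_nonneg {f : Equiv.Perm (Fin n) → ℝ} (h : ∀ σ, 0 ≤ f σ) : 0 ≤ permAvg f :=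
  mul_nonneg (by positivity) (Finset.sum_nonneg fun σ _ => h σ)

lemma permAvg_const (c : ℝ) : permAvg (fun _ : Equiv.Perm (Fin n) => c) = c := by
  have : (n.factorial : ℝ) ≠ 0 := by positivity
  simp [permAvg, Fintype.card_perm]
  field_simp

lemma permAvg_add (f g : Equiv.Perm (Fin n) → ℝ) :
    permAvg (fun σ => f σ + g σ) = permAvg f + permAvg g := by
  simp [permAvg, Finset.sum_add_distrib, mul_add]

lemma permAvg_sum {ι : Type*} (s : Finset ι) (f : ι → Equiv.Perm (Fin n) → ℝ) :
    permAvg (fun σ => ∑ i ∈ s, f i σ) = ∑ i ∈ s, permAvg (f i) := by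
  simp only [permAvg]
  rw [Finset.sum_comm, Finset.mul_sum]

lemma permAvg_le_one {f : Equiv.Perm (Fin n) → ℝ} (h : ∀ σ, f σ ≤ 1) : permAvg f ≤ 1 :=
  (permAvg_mono h).trans_eq (permAvg_const 1)

/-- Post-composing with a swap of two positions does not change an average. -/
lemma permAvg_swap_mul (a b : Fin n) (f : Equiv.Perm (Fin n) → ℝ) :
    permAvg (fun σ => f (Equiv.swap a b * σ)) = permAvg f := by
  simp only [permAvg]
  congr 1
  exact Equiv.sum_comp (Equiv.mulLeft (Equiv.swap a b)) f

/-- Positions from `k` on can be exchanged without disturbing the first `k` agents; this is the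
symmetry behind the conditioning estimate below. -/
lemma initial_swap_mul (σ : Equiv.Perm (Fin n)) {k : ℕ} {a b : Fin n} (ha : k ≤ a) (hb : k ≤ b) :
    initial (Equiv.swap a b * σ) k = initial σ k := by
  ext j
  rw [mem_initial, mem_initial, Equiv.Perm.mul_apply]
  by_cases h1 : σ j = a
  · simp only [h1, Equiv.swap_apply_left]; omega
  · by_cases h2 : σ j = b
    · simp only [h2, Equiv.swap_apply_right]; omega
    · rw [Equiv.swap_apply_of_ne_of_ne h1 h2]

lemma permAvg_position (i j : Fin n) :
    permAvg (fun σ : Equiv.Perm (Fin n) => if σ i = j then (1 : ℝ) else 0) = 1 / n := by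
  have hn : (n : ℝ) ≠ 0 := by
    have := i.pos
    positivity
  have hsame : ∀ j', permAvg (fun σ : Equiv.Perm (Fin n) => if σ i = j' then (1 : ℝ) else 0) =
      permAvg (fun σ : Equiv.Perm (Fin n) => if σ i = j then (1 : ℝ) else 0) := by
    intro j'
    rw [← permAvg_swap_mul j j']
    congr 1
    ext σ
    simp [Equiv.swap_apply_eq_iff]
  have hsum : ∑ j' : Fin n, permAvg (fun σ : Equiv.Perm (Fin n) =>
      if σ i = j' then (1 : ℝ) else 0) = 1 := by
    rw [← permAvg_sum]
    simp [permAvg_const]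
  simp only [hsame, Finset.sum_const, Finset.card_univ, Fintype.card_fin, nsmul_eq_mul] at hsum
  field_simp
  linarith

/-- Conditioning on agent `i` being in position `k` changes the average of a function of the
first `k` agents by at most `k / n`. -/
lemma abs_permAvg_position_sub_le (i k : Fin n) {f : Finset (Fin n) → ℝ}
    (h0 : ∀ S, 0 ≤ f S) (h1 : ∀ S, f S ≤ 1) :
    |n * permAvg (fun σ => if σ i = k then f (initial σ k) else 0) -
      permAvg (fun σ => f (initial σ k))| ≤ (k : ℕ) / n := by
  have hn : (0 : ℝ) < n := by
    have := i.pos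
    positivity
  set A : Fin n → ℝ := fun j => permAvg (fun σ => if σ i = j then f (initial σ k) else 0) with hA
  have hA0 : ∀ j, 0 ≤ A j := fun j => permAvg_nonneg fun σ => by split_ifs <;> simp [h0]
  have hA1 : ∀ j, A j ≤ 1 / n := fun j => by
    rw [← permAvg_position i j]
    exact permAvg_mono fun σ => by split_ifs <;> simp [h1]
  have hsame : ∀ j, k ≤ j → A j = A k := by
    intro j hj
    simp only [hA]
    rw [← permAvg_swap_mul k j]
    congr 1
    ext σ
    rw [initial_swap_mul σ le_rfl (by exact_mod_cast hj)]
    simp [Equiv.swap_apply_eq_iff]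
  have hB : permAvg (fun σ => f (initial σ k)) = ∑ j, A j := by
    rw [← permAvg_sum]
    simp
  -- Positions `j ≥ k` contribute equally by `hsame`, so only the `k` earlier positions survive,
  -- each with a difference of at most `1 / n`.
  have hdiff : n * A k - permAvg (fun σ => f (initial σ k)) =
      ∑ j ∈ Finset.univ.filter (fun j : Fin n => j < k), (A k - A j) := by
    have : (n : ℝ) * A k = ∑ j : Fin n, A k := by simp
    rw [hB, this, ← Finset.sum_sub_distrib, Finset.sum_filter]
    refine Finset.sum_congr rfl fun j _ => ?_
    split_ifs with h
    · rfl
    · rw [hsame j (not_lt.mp h), sub_self]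
  change |n * A k - _| ≤ _
  rw [hdiff]
  refine (Finset.abs_sum_le_sum_abs _ _).trans ?_
  refine (Finset.sum_le_card_nsmul _ _ (1 / (n : ℝ)) ?_).trans ?_
  · intro j _
    rw [abs_le]
    constructor <;> linarith [hA0 j, hA1 j, hA0 k, hA1 k]
  · simp [Finset.filter_gt_eq_Iio, div_eq_mul_inv]

end permAvg

/-! ### Shapley values when only two positions can be pivotal. -/

section shapley

variable {n : ℕ} {w : Fin n → ℝ} {q : ℝ}

lemma shapley_eq_permAvg (i : Fin n) :
    shapley w q i = permAvg fun σ => marginal w q i (predecessors σ i) := rfl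

lemma marginal_nonneg {i : Fin n} (hw : 0 ≤ w i) (S : Finset (Fin n)) :
    0 ≤ marginal w q i S := by
  have hle : ∑ j ∈ S, w j ≤ ∑ j ∈ insert i S, w j := by
    by_cases h : i ∈ S
    · rw [Finset.insert_eq_of_mem h]
    · rw [Finset.sum_insert h]; linarith
  unfold marginal value
  split_ifs with h1 h2 h2
  · simp
  · simp
  · exact absurd (h2.trans hle) h1
  · simp

lemma marginal_le_one (i : Fin n) (S : Finset (Fin n)) : marginal w q i S ≤ 1 := by
  unfold marginal value
  split_ifs <;> simp

lemma shapley_nonneg {i : Fin n} (hw : 0 ≤ w i) : 0 ≤ shapley w q i :=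
  permAvg_nonneg fun _ => marginal_nonneg hw _

lemma shapley_le_one (i : Fin n) : shapley w q i ≤ 1 :=
  permAvg_le_one fun _ => marginal_le_one i _

/-- The Shapley value is invariant under relabelling the agents. -/
lemma shapley_comp_perm (τ : Equiv.Perm (Fin n)) (i : Fin n) :
    shapley (w ∘ τ) q i = shapley w q (τ i) := by
  unfold shapley
  congr 1
  rw [← Equiv.sum_comp (Equiv.mulRight τ)]
  refine Finset.sum_congr rfl fun σ _ => ?_
  have hval : ∀ S : Finset (Fin n), value (w ∘ τ) q S = value w q (S.map τ.toEmbedding) := by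
    intro S
    simp [value]
  have hpred : (predecessors (σ * τ) i).map τ.toEmbedding = predecessors σ (τ i) := by
    ext j
    rw [Finset.mem_map_equiv, mem_predecessors, mem_predecessors]
    simp
  change marginal (w ∘ τ) q i (predecessors (σ * τ) i) = _
  simp only [marginal, hval, Finset.map_insert, hpred]
  rfl

lemma predecessors_eq_initial (σ : Equiv.Perm (Fin n)) (i : Fin n) :
    predecessors σ i = initial σ (σ i) := rfl

open Classical in
/-- If all coalitions of fewer than `ℓ` agents lose and all coalitions of more than `ℓ` agents
win, then an agent can only be pivotal in the positions `ℓ - 1` and `ℓ`. -/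
lemma marginal_predecessors_eq {ℓ : ℕ} (hℓ : 1 ≤ ℓ)
    (hlose : ∀ S : Finset (Fin n), S.card < ℓ → ∑ j ∈ S, w j < q)
    (hwin : ∀ S : Finset (Fin n), ℓ < S.card → q ≤ ∑ j ∈ S, w j)
    (σ : Equiv.Perm (Fin n)) (i : Fin n) :
    marginal w q i (predecessors σ i) =
      (if (σ i : ℕ) = ℓ then (if ∑ j ∈ initial σ ℓ, w j < q then 1 else 0) else 0) +
      (if (σ i : ℕ) = ℓ - 1 then
        (if q - w i ≤ ∑ j ∈ initial σ (ℓ - 1), w j then 1 else 0) else 0) := by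
  have hcard : (predecessors σ i).card = σ i := by
    rw [predecessors_eq_initial, card_initial _ (σ i).isLt.le]
  have hi : i ∉ predecessors σ i := by simp [predecessors]
  have hcard' : (insert i (predecessors σ i)).card = σ i + 1 := by
    rw [Finset.card_insert_of_notMem hi, hcard]
  have hsum := Finset.sum_insert (f := w) hi
  unfold marginal value
  -- Positions count from `0`: agent `i` has `σ i` predecessors, and the coalition it completes has
  -- `σ i + 1` members.
  rcases lt_trichotomy ((σ i : ℕ) + 1) ℓ with h | h | h
  · have h1 := hlose _ (hcard'.trans_lt h)
    have h2 := hlose (predecessors σ i) (by omega)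
    rw [if_neg (not_le.mpr h1), if_neg (not_le.mpr h2), if_neg (by omega), if_neg (by omega)]
    simp
  · have h2 := hlose (predecessors σ i) (by omega)
    rw [if_neg (not_le.mpr h2), if_neg (by omega : ¬ (σ i : ℕ) = ℓ),
      if_pos (by omega : (σ i : ℕ) = ℓ - 1), hsum]
    have : predecessors σ i = initial σ (ℓ - 1) := by
      rw [predecessors_eq_initial]; congr 1; omega
    rw [← this, sub_zero, zero_add]
    congr 1
    rw [eq_iff_iff, sub_le_iff_le_add, add_comm]
  · have h1 := hwin (insert i (predecessors σ i)) (by omega)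
    rw [if_pos h1, if_neg (by omega : ¬ (σ i : ℕ) = ℓ - 1)]
    by_cases h3 : (σ i : ℕ) = ℓ
    · have : predecessors σ i = initial σ ℓ := by
        rw [predecessors_eq_initial]; congr 1
      rw [if_pos h3, this]
      by_cases h4 : q ≤ ∑ j ∈ initial σ ℓ, w j
      · rw [if_pos h4, if_neg (not_lt.mpr h4)]; simp
      · rw [if_neg h4, if_pos (not_le.mp h4)]; simp
    · have h2 := hwin (predecessors σ i) (by omega)
      rw [if_pos h2, if_neg h3]; simp

-- Each of the two pivotal positions costs at most `ℓ / n` for decoupling. The term from position `ℓ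
-- - 1` is nonnegative and only needs an upper bound, so its average joins the error.
open Classical in
lemma abs_mul_shapley_sub_le {ℓ : ℕ} (hℓ : 1 ≤ ℓ) (hℓn : ℓ < n)
    (hlose : ∀ S : Finset (Fin n), S.card < ℓ → ∑ j ∈ S, w j < q)
    (hwin : ∀ S : Finset (Fin n), ℓ < S.card → q ≤ ∑ j ∈ S, w j) (i : Fin n) :
    |n * shapley w q i - permAvg fun σ => if ∑ j ∈ initial σ ℓ, w j < q then 1 else 0| ≤
      2 * ℓ / n + permAvg fun σ =>
        if q - w i ≤ ∑ j ∈ initial σ (ℓ - 1), w j then 1 else 0 := by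
  have hn : (0 : ℝ) < n := by
    have := i.pos
    positivity
  have e1 := abs_permAvg_position_sub_le i ⟨ℓ, hℓn⟩
    (f := fun S => if ∑ j ∈ S, w j < q then 1 else 0)
    (fun S => by split_ifs <;> simp) (fun S => by split_ifs <;> simp)
  have e2 := abs_permAvg_position_sub_le i ⟨ℓ - 1, by omega⟩
    (f := fun S => if q - w i ≤ ∑ j ∈ S, w j then 1 else 0)
    (fun S => by split_ifs <;> simp) (fun S => by split_ifs <;> simp)
  have hnn : 0 ≤ permAvg (fun σ : Equiv.Perm (Fin n) => if σ i = ⟨ℓ - 1, by omega⟩ then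
      (if q - w i ≤ ∑ j ∈ initial σ (ℓ - 1), w j then (1 : ℝ) else 0) else 0) :=
    permAvg_nonneg fun σ => by split_ifs <;> simp
  have hle : ((ℓ - 1 : ℕ) : ℝ) / n ≤ ℓ / n := by
    gcongr
    omega
  rw [shapley_eq_permAvg]
  simp_rw [marginal_predecessors_eq hℓ hlose hwin]
  rw [permAvg_add]
  simp only [Fin.ext_iff] at e1 e2 hnn
  rw [abs_le] at e1 e2 ⊢
  have : 2 * (ℓ : ℝ) / n = ℓ / n + ℓ / n := by ring
  have hnn' := mul_nonneg hn.le hnn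
  have hb : 0 ≤ permAvg (fun σ : Equiv.Perm (Fin n) =>
      if q - w i ≤ ∑ j ∈ initial σ (ℓ - 1), w j then (1 : ℝ) else 0) :=
    permAvg_nonneg fun σ => by split_ifs <;> simp
  constructor <;> linarith [e1.1, e1.2, e2.1, e2.2]

end shapley

/-! ### Balls and bins: product structure, symmetry, concentration. -/

/-- The number of balls that land in a given set of bins. -/
def hits {m n : ℕ} (ω : Fin m → Fin n) (S : Finset (Fin n)) : ℕ :=
  (Finset.univ.filter fun b => ω b ∈ S).card

section ballsAndBins

variable {m n : ℕ}

lemma sum_load (ω : Fin m → Fin n) (S : Finset (Fin n)) : ∑ i ∈ S, load ω i = hits ω S := by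
  unfold hits load
  rw [Finset.card_eq_sum_card_fiberwise (f := ω) (t := S) (by intro b; simp)]
  refine Finset.sum_congr rfl fun i hi => ?_
  congr 1
  ext b
  simp only [Finset.mem_filter, Finset.mem_univ, true_and]
  constructor
  · rintro rfl; exact ⟨hi, rfl⟩
  · exact fun h => h.2

lemma sum_load_cast (ω : Fin m → Fin n) (S : Finset (Fin n)) :
    ∑ i ∈ S, (load ω i : ℝ) = hits ω S := by
  rw [← sum_load]; push_cast; rfl

lemma hits_eq_sum (ω : Fin m → Fin n) (S : Finset (Fin n)) :
    (hits ω S : ℝ) = ∑ b, if ω b ∈ S then (1 : ℝ) else 0 := by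
  simp [hits]

lemma hits_singleton (ω : Fin m → Fin n) (i : Fin n) : hits ω {i} = load ω i := by
  rw [← sum_load, Finset.sum_singleton]

lemma measurable_ballsAndBins {β : Type*} [MeasurableSpace β] (f : (Fin m → Fin n) → β) :
    Measurable f := measurable_of_finite f

lemma uniformOn_fin_singleton (i : Fin n) :
    ProbabilityTheory.uniformOn (Set.univ : Set (Fin n)) {i} = (n : ENNReal)⁻¹ := by
  rw [ProbabilityTheory.uniformOn_univ]
  simp

lemma integral_ite_ballsAndBins (P : (Fin m → Fin n) → Prop) [DecidablePred P] :
    ∫ ω, (if P ω then (1 : ℝ) else 0) ∂(ballsAndBins m n) = (ballsAndBins m n).real {ω | P ω} := by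
  rw [← integral_indicator_one (Set.toFinite _).measurableSet]
  congr 1
  ext ω
  simp [Set.indicator_apply]

lemma integral_uniformOn_fin {E : Type*} [NormedAddCommGroup E] [NormedSpace ℝ E]
    [CompleteSpace E] (f : Fin n → E) :
    ∫ i, f i ∂(ProbabilityTheory.uniformOn (Set.univ : Set (Fin n))) =
      (n : ℝ)⁻¹ • ∑ i, f i := by
  rw [integral_fintype .of_finite, Finset.smul_sum]
  simp [Measure.real, uniformOn_fin_singleton]

lemma ballsAndBins_real_singleton (ω : Fin m → Fin n) :
    (ballsAndBins m n).real {ω} = ((n : ℝ)⁻¹) ^ m := by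
  simp [Measure.real, ballsAndBins, Measure.pi_singleton, uniformOn_fin_singleton]

variable [NeZero n]

instance isProbabilityMeasure_uniformOn_fin :
    IsProbabilityMeasure (ProbabilityTheory.uniformOn (Set.univ : Set (Fin n))) :=
  ProbabilityTheory.isProbabilityMeasure_uniformOn Set.finite_univ Set.univ_nonempty

instance isProbabilityMeasure_ballsAndBins : IsProbabilityMeasure (ballsAndBins m n) := by
  unfold ballsAndBins
  infer_instance

lemma integral_ballsAndBins (f : (Fin m → Fin n) → ℝ) :
    ∫ ω, f ω ∂(ballsAndBins m n) = ((n : ℝ)⁻¹) ^ m * ∑ ω, f ω := by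
  rw [integral_fintype .of_finite, Finset.mul_sum]
  simp [ballsAndBins_real_singleton]

lemma integral_prod_ballsAndBins (f : Fin n → ℂ) :
    ∫ ω, ∏ b, f (ω b) ∂(ballsAndBins m n) = ((n : ℝ)⁻¹ • ∑ i, f i) ^ m := by
  unfold ballsAndBins
  rw [integral_fintype_prod_eq_pow, integral_uniformOn_fin, Fintype.card_fin]

/-- Averaging over the balls can be done one ball at a time. -/
lemma integral_ballsAndBins_succ (f : (Fin (m + 1) → Fin n) → ℝ) :
    ∫ ω, f ω ∂(ballsAndBins (m + 1) n) =
      (n : ℝ)⁻¹ * ∑ i, ∫ ω, f (Fin.cons i ω) ∂(ballsAndBins m n) := by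
  simp_rw [integral_ballsAndBins]
  rw [← Equiv.sum_comp (Fin.consEquiv fun _ => Fin n), Fintype.sum_prod_type,
    ← Finset.mul_sum, ← mul_assoc, pow_succ']
  rfl

/-- Averaging over the balls can be done in two blocks. -/
lemma integral_ballsAndBins_add (m₁ m₂ : ℕ) (f : (Fin (m₁ + m₂) → Fin n) → ℝ) :
    ∫ ω, f ω ∂(ballsAndBins (m₁ + m₂) n) =
      ∫ ω₁, ∫ ω₂, f (Fin.append ω₁ ω₂) ∂(ballsAndBins m₂ n) ∂(ballsAndBins m₁ n) := by
  simp_rw [integral_ballsAndBins]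
  rw [← Equiv.sum_comp (Fin.appendEquiv m₁ m₂), Fintype.sum_prod_type,
    ← Finset.mul_sum, ← mul_assoc, pow_add]
  rfl

/-- The number of hits of a set of bins depends, in law, only on the number of bins. -/
lemma integral_hits_congr {S T : Finset (Fin n)} (h : S.card = T.card) (f : ℝ → ℝ) :
    ∫ ω, f (hits ω S) ∂(ballsAndBins m n) = ∫ ω, f (hits ω T) ∂(ballsAndBins m n) := by
  obtain ⟨π, hπ⟩ : ∃ π : Equiv.Perm (Fin n), ∀ i, π i ∈ T ↔ i ∈ S := by
    classical
    have e : {i // i ∈ S} ≃ {i // i ∈ T} := Fintype.equivOfCardEq (by simpa using h)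
    exact ⟨e.extendSubtype, fun i => ⟨fun hi => by
      by_contra hS
      exact e.extendSubtype_not_mem i hS hi, fun hi => e.extendSubtype_mem i hi⟩⟩
  rw [integral_ballsAndBins, integral_ballsAndBins]
  congr 1
  rw [← Equiv.sum_comp (Equiv.arrowCongr (Equiv.refl (Fin m)) π) fun ω => f (hits ω T)]
  refine Finset.sum_congr rfl fun ω _ => ?_
  simp [hits, hπ]

lemma measureReal_hits_congr {S T : Finset (Fin n)} (h : S.card = T.card) (P : ℝ → Prop) :
    (ballsAndBins m n).real {ω | P (hits ω S)} = (ballsAndBins m n).real {ω | P (hits ω T)} := by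
  classical
  rw [← integral_ite_ballsAndBins, ← integral_ite_ballsAndBins]
  exact integral_hits_congr h fun x => if P x then 1 else 0

lemma integral_mem_uniformOn (S : Finset (Fin n)) :
    ∫ i, (if i ∈ S then (1 : ℝ) else 0) ∂(ProbabilityTheory.uniformOn (Set.univ : Set (Fin n))) =
      S.card / n := by
  rw [integral_uniformOn_fin]
  simp [div_eq_inv_mul]

lemma integral_mem_ballsAndBins (S : Finset (Fin n)) (b : Fin m) :
    ∫ ω, (if ω b ∈ S then (1 : ℝ) else 0) ∂(ballsAndBins m n) = S.card / n := by
  rw [← integral_mem_uniformOn S]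
  exact integral_comp_eval (X := fun _ : Fin m => Fin n) (i := b)
    (μ := fun _ : Fin m => ProbabilityTheory.uniformOn Set.univ)
    (f := fun i : Fin n => if i ∈ S then (1 : ℝ) else 0)
    (measurable_of_finite _).aestronglyMeasurable

lemma integral_hits (S : Finset (Fin n)) :
    ∫ ω, (hits ω S : ℝ) ∂(ballsAndBins m n) = m * (S.card / n) := by
  simp_rw [hits_eq_sum]
  rw [integral_finsetSum _ fun _ _ => .of_finite]
  simp [integral_mem_ballsAndBins]

lemma iIndepFun_mem (S : Finset (Fin n)) :
    ProbabilityTheory.iIndepFun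
      (fun (b : Fin m) (ω : Fin m → Fin n) => if ω b ∈ S then (1 : ℝ) else 0)
      (ballsAndBins m n) :=
  ProbabilityTheory.iIndepFun_pi (X := fun _ i => if i ∈ S then (1 : ℝ) else 0)
    fun _ => (measurable_of_finite _).aemeasurable

lemma memLp_ballsAndBins (f : (Fin m → Fin n) → ℝ) (p : ENNReal) :
    MemLp f p (ballsAndBins m n) := MemLp.of_discrete

/-- The indicators are independent, and the variance of an indicator is at most its second moment,
which equals its mean. -/
lemma variance_hits_le (S : Finset (Fin n)) :
    ProbabilityTheory.variance (fun ω => (hits ω S : ℝ)) (ballsAndBins m n) ≤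
      m * (S.card / n) := by
  have h : (fun ω : Fin m → Fin n => (hits ω S : ℝ)) =
      ∑ b, fun ω => if ω b ∈ S then (1 : ℝ) else 0 := by
    ext ω
    rw [hits_eq_sum, Finset.sum_apply]
  rw [h, ProbabilityTheory.IndepFun.variance_sum (fun _ _ => memLp_ballsAndBins _ _)
    fun b _ c _ hbc => (iIndepFun_mem S).indepFun hbc]
  have hb : ∀ b : Fin m, ProbabilityTheory.variance
      (fun ω : Fin m → Fin n => if ω b ∈ S then (1 : ℝ) else 0) (ballsAndBins m n) ≤
        S.card / n := fun b => by
    refine (ProbabilityTheory.variance_le_expectation_sq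
      (measurable_ballsAndBins _).aestronglyMeasurable).trans_eq ?_
    rw [← integral_mem_ballsAndBins S b]
    simp
  refine (Finset.sum_le_card_nsmul _ _ _ fun b _ => hb b).trans_eq ?_
  simp

lemma measureReal_hits_ge_le {S : Finset (Fin n)} {c : ℝ} (hc : 0 < c) :
    (ballsAndBins m n).real {ω | m * ((S.card : ℝ) / n) + c ≤ hits ω S} ≤
      m * (S.card / n) / c ^ 2 := by
  have h := ProbabilityTheory.meas_ge_le_variance_div_sq
    (memLp_ballsAndBins (fun ω : Fin m → Fin n => (hits ω S : ℝ)) 2) hc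
  rw [integral_hits] at h
  have hv := ProbabilityTheory.variance_nonneg
    (fun ω => (hits ω S : ℝ)) (ballsAndBins m n)
  calc (ballsAndBins m n).real {ω | m * ((S.card : ℝ) / n) + c ≤ hits ω S}
      ≤ (ballsAndBins m n).real {ω | c ≤ |(hits ω S : ℝ) - m * (S.card / n)|} := by
        refine measureReal_mono fun ω hω => ?_
        simp only [Set.mem_ofPred_eq] at hω ⊢
        exact le_trans (by linarith) (le_abs_self _)
    _ ≤ ProbabilityTheory.variance (fun ω => (hits ω S : ℝ)) (ballsAndBins m n) / c ^ 2 :=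
        ENNReal.toReal_le_of_le_ofReal (by positivity) h
    _ ≤ _ := by
        gcongr
        exact variance_hits_le S

/-- Hoeffding's inequality for the load of a bin. -/
lemma measureReal_abs_load_sub_ge_le (i : Fin n) {c : ℝ} (hc : 0 ≤ c) :
    (ballsAndBins m n).real {ω | c ≤ |(load ω i : ℝ) - m / n|} ≤
      2 * Real.exp (-(2 * c ^ 2 / m)) := by
  set X : Fin m → (Fin m → Fin n) → ℝ := fun b ω => if ω b ∈ ({i} : Finset (Fin n)) then 1 else 0
    with hX
  have hXint : ∀ b, ∫ ω, X b ω ∂(ballsAndBins m n) = 1 / n := fun b => by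
    simpa only [Finset.card_singleton, Nat.cast_one] using
      integral_mem_ballsAndBins ({i} : Finset (Fin n)) b
  have hind : ProbabilityTheory.iIndepFun (fun b ω => X b ω - 1 / n) (ballsAndBins m n) :=
    (iIndepFun_mem ({i} : Finset (Fin n))).comp (fun _ x => x - 1 / n) fun _ => by fun_prop
  -- The proxy `1 / 4` is the squared half-length of `[0, 1]`.
  have hsub : ∀ b, ProbabilityTheory.HasSubgaussianMGF (fun ω => X b ω - 1 / n) (1 / 4)
      (ballsAndBins m n) := fun b => by
    have := ProbabilityTheory.hasSubgaussianMGF_of_mem_Icc (X := X b) (a := 0) (b := 1)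
      (μ := ballsAndBins m n) (measurable_ballsAndBins _).aemeasurable
      (ae_of_all _ fun ω => by simp only [hX]; split_ifs <;> simp)
    rw [hXint b] at this
    convert this using 1
    ext
    norm_num
  have hsum : ∀ ω, ∑ b, (X b ω - 1 / n) = (load ω i : ℝ) - m / n := fun ω => by
    rw [Finset.sum_sub_distrib, ← hits_eq_sum, hits_singleton]
    simp [div_eq_mul_inv]
  have hexp : -c ^ 2 / (2 * ((∑ _b : Fin m, (1 / 4) : NNReal) : ℝ)) = -(2 * c ^ 2 / m) := by
    push_cast
    simp only [Finset.sum_const, Finset.card_univ, Fintype.card_fin, nsmul_eq_mul]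
    rw [show 2 * ((m : ℝ) * (1 / 4)) = m / 2 by ring, div_div_eq_mul_div]
    ring
  have h1 := ProbabilityTheory.HasSubgaussianMGF.measure_sum_ge_le_of_iIndepFun hind
    (s := Finset.univ) (fun b _ => hsub b) hc
  have h2 := ProbabilityTheory.HasSubgaussianMGF.measure_sum_ge_le_of_iIndepFun
    (X := fun b ω => -(X b ω - 1 / n))
    (hind.comp (fun _ x => -x) fun _ => by fun_prop)
    (s := Finset.univ) (fun b _ => (hsub b).neg) hc
  rw [hexp] at h1 h2
  simp only [Finset.sum_neg_distrib, hsum] at h1 h2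
  calc _ ≤ (ballsAndBins m n).real ({ω | c ≤ (load ω i : ℝ) - m / n} ∪
        {ω | c ≤ -((load ω i : ℝ) - m / n)}) := by
        refine measureReal_mono fun ω hω => ?_
        simpa [le_abs] using hω
    _ ≤ _ := (measureReal_union_le _ _).trans (by linarith)

lemma measureReal_exists_abs_load_sub_ge_le {c : ℝ} (hc : 0 ≤ c) :
    (ballsAndBins m n).real {ω | ∃ i, c ≤ |(load ω i : ℝ) - m / n|} ≤
      2 * n * Real.exp (-(2 * c ^ 2 / m)) := by
  rw [Set.ofPred_exists]
  refine (measureReal_iUnion_fintype_le _).trans ?_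
  refine (Finset.sum_le_card_nsmul _ _ _ fun i _ => measureReal_abs_load_sub_ge_le i hc).trans_eq ?_
  simp only [Finset.card_univ, Fintype.card_fin, nsmul_eq_mul]
  ring

end ballsAndBins

/-! ### Characteristic functions: binomial to Poisson to normal. -/

section charFun

open Complex Topology

lemma norm_pow_sub_pow_le_of_norm_le_one {x y : ℂ} (hx : ‖x‖ ≤ 1) (hy : ‖y‖ ≤ 1) (k : ℕ) :
    ‖x ^ k - y ^ k‖ ≤ k * ‖x - y‖ := by
  induction k with
  | zero => simp
  | succ k ih =>
    have h : x ^ (k + 1) - y ^ (k + 1) = x ^ k * (x - y) + (x ^ k - y ^ k) * y := by ring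
    have h1 : ‖x ^ k * (x - y)‖ ≤ ‖x - y‖ := by
      rw [norm_mul, norm_pow]
      exact mul_le_of_le_one_left (norm_nonneg _) (pow_le_one₀ (norm_nonneg _) hx)
    have h2 : ‖(x ^ k - y ^ k) * y‖ ≤ k * ‖x - y‖ := by
      rw [norm_mul]
      exact (mul_le_of_le_one_right (norm_nonneg _) hy).trans ih
    rw [h]
    push_cast
    linarith [norm_add_le (x ^ k * (x - y)) ((x ^ k - y ^ k) * y)]

lemma norm_exp_mul_I_sub_one_le (u : ℝ) : ‖exp (u * I) - 1‖ ≤ |u| := by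
  rw [mul_comm]
  exact Real.norm_exp_I_mul_ofReal_sub_one_le

/-- Poisson approximation of the characteristic function of a binomial law. -/
lemma norm_one_add_mul_pow_sub_exp_le {p u : ℝ} (hp0 : 0 ≤ p) (hp1 : p ≤ 1) (hpu : p * |u| ≤ 1)
    (k : ℕ) :
    ‖(1 + p * (exp (u * I) - 1)) ^ k - exp (k * (p * (exp (u * I) - 1)))‖ ≤
      k * (p * |u|) ^ 2 := by
  set z : ℂ := exp (u * I) - 1 with hz
  have hnz : ‖(p : ℂ) * z‖ ≤ p * |u| := by
    rw [norm_mul, norm_real, Real.norm_eq_abs, abs_of_nonneg hp0]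
    gcongr
    exact norm_exp_mul_I_sub_one_le u
  have hx : ‖1 + (p : ℂ) * z‖ ≤ 1 := by
    -- A convex combination of two points of the unit circle, hence in the unit disc.
    have h : 1 + (p : ℂ) * z = ((1 - p : ℝ) : ℂ) + p * exp (u * I) := by
      rw [hz]; push_cast; ring
    rw [h]
    refine (norm_add_le _ _).trans ?_
    rw [norm_mul, norm_real, norm_real, norm_exp_ofReal_mul_I, Real.norm_of_nonneg hp0,
      Real.norm_of_nonneg (by linarith)]
    linarith
  have hy : ‖exp ((p : ℂ) * z)‖ ≤ 1 := by
    rw [norm_exp, Real.exp_le_one_iff, re_ofReal_mul, hz, sub_re, one_re, exp_ofReal_mul_I_re]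
    exact mul_nonpos_of_nonneg_of_nonpos hp0 (by linarith [Real.cos_le_one u])
  rw [exp_nat_mul]
  refine (norm_pow_sub_pow_le_of_norm_le_one hx hy k).trans ?_
  gcongr
  rw [norm_sub_rev, ← sub_sub]
  exact (norm_exp_sub_one_sub_id_le (hnz.trans hpu)).trans (by gcongr)

lemma norm_exp_mul_I_sub_taylor_le {u : ℝ} (hu : |u| ≤ 1) :
    ‖exp (u * I) - 1 - u * I + u ^ 2 / 2‖ ≤ |u| ^ 3 := by
  have hn : ‖(u : ℂ) * I‖ = |u| := by simp
  have h := exp_bound (x := u * I) (hn.trans_le hu) (n := 3) (by norm_num)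
  rw [hn] at h
  have e : exp (u * I) - ∑ m ∈ Finset.range 3, (u * I) ^ m / (m.factorial : ℂ) =
      exp (u * I) - 1 - u * I + u ^ 2 / 2 := by
    simp [Finset.sum_range_succ, mul_pow]
    ring
  rw [e] at h
  refine h.trans ?_
  have : 0 ≤ |u| ^ 3 := by positivity
  norm_num [Nat.factorial]
  linarith

/-- The characteristic functions of normalized binomial laws converge to that of the
normal law if the success probability tends to `0` and the mean to infinity. -/
lemma tendsto_charFun_binomial {k : ℕ → ℕ} {p : ℕ → ℝ} (hp0 : ∀ j, 0 ≤ p j)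
    (hp : Tendsto p atTop (𝓝 0)) (hkp : Tendsto (fun j => k j * p j) atTop atTop) (t : ℝ) :
    Tendsto (fun j => exp (-(t * √(k j * p j) : ℝ) * I) *
      (1 + p j * (exp ((t / √(k j * p j) : ℝ) * I) - 1)) ^ k j) atTop
      (𝓝 (exp (-(t ^ 2 / 2 : ℝ)))) := by
  set s : ℕ → ℝ := fun j => √(k j * p j) with hs
  set u : ℕ → ℝ := fun j => t / s j with hu
  have hsinf : Tendsto s atTop atTop := Real.tendsto_sqrt_atTop.comp hkp
  have hu0 : Tendsto u atTop (𝓝 0) := hsinf.const_div_atTop t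
  have hspos : ∀ᶠ j in atTop, 0 < s j := hsinf.eventually_gt_atTop 0
  have hssq : ∀ j, s j ^ 2 = k j * p j := fun j =>
    Real.sq_sqrt (mul_nonneg (Nat.cast_nonneg _) (hp0 j))
  have hp1 : ∀ᶠ j in atTop, p j ≤ 1 := hp.eventually_le_const one_pos
  have hu1 : ∀ᶠ j in atTop, |u j| ≤ 1 := by
    have := hu0.abs
    rw [abs_zero] at this
    exact this.eventually_le_const one_pos
  -- The centred Poisson factor: since `s * u = t`, the quadratic Taylor term gives `-t ^ 2 / 2` and
  -- the cubic remainder is at most `s ^ 2 * |u| ^ 3 = t ^ 2 * |u|`.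
  have hexp : Tendsto (fun j => exp ((s j : ℂ) ^ 2 * (exp (u j * I) - 1 - u j * I))) atTop
      (𝓝 (exp (-(t ^ 2 / 2 : ℝ)))) := by
    refine (continuous_exp.tendsto _).comp ?_
    rw [tendsto_iff_norm_sub_tendsto_zero]
    have hlim : Tendsto (fun j => t ^ 2 * |u j|) atTop (𝓝 0) := by
      simpa using hu0.abs.const_mul (t ^ 2)
    refine squeeze_zero' (.of_forall fun _ => norm_nonneg _) ?_ hlim
    filter_upwards [hspos, hu1] with j hsj huj
    have hsu : s j * u j = t := by simp only [hu]; field_simp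
    have e : (s j : ℂ) ^ 2 * (exp (u j * I) - 1 - u j * I) - (-(t ^ 2 / 2 : ℝ) : ℂ) =
        (s j : ℂ) ^ 2 * (exp (u j * I) - 1 - u j * I + u j ^ 2 / 2) := by
      rw [← hsu]; push_cast; ring
    rw [e, norm_mul, norm_pow, norm_real, Real.norm_of_nonneg hsj.le]
    calc s j ^ 2 * _ ≤ s j ^ 2 * |u j| ^ 3 := by
          gcongr; exact norm_exp_mul_I_sub_taylor_le huj
      _ = t ^ 2 * |u j| := by
          rw [← hsu, pow_succ |u j| 2, sq_abs]; ring
  -- The Poisson approximation costs `k * (p * u) ^ 2 = t ^ 2 * p`, because `k * p = s ^ 2`.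
  have hdiff : Tendsto (fun j => exp (-(t * s j : ℝ) * I) *
      (1 + p j * (exp ((u j : ℝ) * I) - 1)) ^ k j -
        exp ((s j : ℂ) ^ 2 * (exp (u j * I) - 1 - u j * I))) atTop (𝓝 0) := by
    rw [tendsto_zero_iff_norm_tendsto_zero]
    have hlim : Tendsto (fun j => t ^ 2 * p j) atTop (𝓝 0) := by
      simpa using hp.const_mul (t ^ 2)
    refine squeeze_zero' (.of_forall fun _ => norm_nonneg _) ?_ hlim
    filter_upwards [hspos, hu1, hp1] with j hsj huj hpj
    have hsu : s j * u j = t := by simp only [hu]; field_simp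
    have e : exp ((s j : ℂ) ^ 2 * (exp (u j * I) - 1 - u j * I)) =
        exp (-(t * s j : ℝ) * I) * exp (k j * (p j * (exp (u j * I) - 1))) := by
      rw [← exp_add]
      congr 1
      have h2 : (k j : ℂ) * p j = (s j : ℂ) ^ 2 := by exact_mod_cast (hssq j).symm
      rw [← mul_assoc, h2, ← hsu]
      push_cast
      ring
    have hn : ‖exp (-(t * s j : ℝ) * I)‖ = 1 := by
      rw [← ofReal_neg]
      exact norm_exp_ofReal_mul_I _
    rw [e, ← mul_sub, norm_mul, hn, one_mul]
    refine (norm_one_add_mul_pow_sub_exp_le (hp0 j) hpj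
      (mul_le_one₀ hpj (abs_nonneg _) huj) _).trans_eq ?_
    rw [mul_pow, sq_abs, ← hsu]
    have := hssq j
    linear_combination (-(u j) ^ 2 * p j) * this
  have hadd := hdiff.add hexp
  simp only [sub_add_cancel, zero_add] at hadd
  exact hadd

end charFun

/-! ### Central limit theorem for the content of a set of bins. -/

section centralLimit

open ProbabilityTheory Topology

lemma charFun_map_hits {m n : ℕ} [NeZero n] (S : Finset (Fin n)) (t : ℝ) :
    charFun ((ballsAndBins m n).map fun ω => (hits ω S : ℝ)) t =
      (1 + ((S.card : ℝ) / n : ℝ) * (Complex.exp (t * Complex.I) - 1)) ^ m := by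
  rw [charFun_apply_real, integral_map (measurable_ballsAndBins _).aemeasurable (by fun_prop)]
  have h : ∀ ω : Fin m → Fin n, Complex.exp (t * ((hits ω S : ℝ) : ℂ) * Complex.I) =
      ∏ b, (if ω b ∈ S then Complex.exp (t * Complex.I) else 1) := fun ω => by
    rw [Finset.prod_ite, Finset.prod_const, Finset.prod_const_one, mul_one, ← Complex.exp_nat_mul]
    unfold hits
    congr 1
    push_cast
    ring
  simp_rw [h]
  rw [integral_prod_ballsAndBins fun i => if i ∈ S then Complex.exp (t * Complex.I) else 1]
  congr 1
  have h2 : ∀ i : Fin n, (if i ∈ S then Complex.exp (t * Complex.I) else 1) =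
      1 + if i ∈ S then Complex.exp (t * Complex.I) - 1 else 0 := fun i => by
    split_ifs <;> ring
  simp_rw [h2]
  rw [Finset.sum_add_distrib]
  have hn : (n : ℂ) ≠ 0 := by exact_mod_cast NeZero.ne n
  simp
  field_simp

/-- The central limit theorem for the number of balls in a set of bins, if the proportion of
bins tends to `0` and the mean number of balls tends to infinity. -/
theorem tendsto_measureReal_hits {N M : ℕ → ℕ} [∀ j, NeZero (N j)] (S : ∀ j, Finset (Fin (N j)))
    (hp : Tendsto (fun j => ((S j).card : ℝ) / N j) atTop (𝓝 0))
    (hM : Tendsto (fun j => (M j : ℝ) * ((S j).card / N j)) atTop atTop)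
    {E : Set ℝ} (hEm : MeasurableSet E) (hE : gaussianReal 0 1 (frontier E) = 0) :
    Tendsto (fun j => (ballsAndBins (M j) (N j)).real {ω |
      ((hits ω (S j) : ℝ) - M j * ((S j).card / N j)) / √(M j * ((S j).card / N j)) ∈ E})
      atTop (𝓝 ((gaussianReal 0 1).real E)) := by
  set c : ℕ → ℝ := fun j => M j * ((S j).card / N j) with hc
  have hc0 : ∀ j, 0 ≤ c j := fun j => by positivity
  set X : ∀ j, (Fin (M j) → Fin (N j)) → ℝ := fun j ω => (hits ω (S j) - c j) / √(c j) with hX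
  have hprob : ∀ j, IsProbabilityMeasure ((ballsAndBins (M j) (N j)).map (X j)) := fun j =>
    Measure.isProbabilityMeasure_map (measurable_ballsAndBins _).aemeasurable
  let ν : ℕ → ProbabilityMeasure ℝ := fun j => ⟨(ballsAndBins (M j) (N j)).map (X j), hprob j⟩
  let γ : ProbabilityMeasure ℝ := ⟨gaussianReal 0 1, inferInstance⟩
  have hlim : Tendsto ν atTop (𝓝 γ) := by
    rw [ProbabilityMeasure.tendsto_iff_tendsto_charFun]
    intro t
    have h := tendsto_charFun_binomial (k := M) (p := fun j => ((S j).card : ℝ) / N j)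
      (fun j => by positivity) hp hM t
    simp only [ν, γ, ProbabilityMeasure.coe_mk]
    rw [charFun_gaussianReal]
    convert h using 2 with j
    · rw [← charFun_map_hits, charFun_apply_real, charFun_apply_real,
        integral_map (measurable_ballsAndBins _).aemeasurable (by fun_prop),
        integral_map (measurable_ballsAndBins _).aemeasurable (by fun_prop),
        ← integral_const_mul]
      refine integral_congr_ae (ae_of_all _ fun ω => ?_)
      simp only [hX]
      rw [← Complex.exp_add]
      congr 1
      have hs : c j / √(c j) = √(c j) := Real.div_sqrt
      have e : t * ((hits ω (S j) - c j) / √(c j)) =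
          -(t * √(c j)) + t / √(c j) * hits ω (S j) := by
        rw [sub_div, hs]; ring
      rw [← Complex.ofReal_mul, e]
      push_cast
      ring
    · simp
  have h := ProbabilityMeasure.tendsto_measure_of_null_frontier_of_tendsto' hlim hE
  have h' := (ENNReal.tendsto_toReal (measure_ne_top _ _)).comp h
  refine h'.congr fun j => ?_
  simp only [ν, Function.comp, ProbabilityMeasure.coe_mk]
  rw [Measure.map_apply (measurable_ballsAndBins _) hEm]
  rfl

lemma gaussianReal_real_Iio_zero : (gaussianReal 0 1).real (Set.Iio 0) = 1 / 2 := by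
  have : NullSingletonClass (gaussianReal 0 1) := nullSingletonClass_gaussianReal one_ne_zero
  have hneg : (gaussianReal 0 1).real (Set.Ioi 0) = (gaussianReal 0 1).real (Set.Iio 0) := by
    conv_rhs => rw [← neg_zero (G := ℝ), ← gaussianReal_map_neg]
    rw [map_measureReal_apply (by fun_prop) measurableSet_Iio]
    congr 1
    ext x
    simp
  have hIci : (gaussianReal 0 1).real (Set.Ici 0) = (gaussianReal 0 1).real (Set.Ioi 0) :=
    measureReal_congr Ioi_ae_eq_Ici.symm
  have hcompl := probReal_compl_eq_one_sub (μ := gaussianReal 0 1) (s := Set.Iio (0 : ℝ))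
    measurableSet_Iio
  rw [Set.compl_Iio, hIci, hneg] at hcompl
  linarith

/-- Supplies the constant chance that one block of balls falls two standard deviations short. -/
lemma gaussianReal_real_Iic_pos (x : ℝ) : 0 < (gaussianReal 0 1).real (Set.Iic x) := by
  refine ENNReal.toReal_pos (fun h => ?_) (measure_ne_top _ _)
  have := gaussianReal_absolutelyContinuous' 0 (one_ne_zero (α := NNReal)) h
  simp at this

end centralLimit

/-! ### Negative dependence of the loads. -/

section negativeDependence

/-- The left side is the part of the expanded right side of degree at most one in `d`; the dropped
terms are nonnegative. It compares one ball, which raises a single bin, with separate increments in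
every bin. -/
lemma prod_add_sum_mul_prod_erase_le {ι : Type*} [DecidableEq ι] (s : Finset ι) {a d : ι → ℝ}
    (ha : ∀ i, 0 ≤ a i) (hd : ∀ i, 0 ≤ d i) :
    ∏ i ∈ s, a i + ∑ b ∈ s, d b * ∏ i ∈ s.erase b, a i ≤ ∏ i ∈ s, (a i + d i) := by
  induction s using Finset.induction_on with
  | empty => simp
  | insert c s hc ih =>
    rw [Finset.prod_insert hc, Finset.prod_insert hc, Finset.sum_insert hc, Finset.erase_insert hc]
    have h1 : ∑ b ∈ s, d b * ∏ i ∈ (insert c s).erase b, a i =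
        a c * ∑ b ∈ s, d b * ∏ i ∈ s.erase b, a i := by
      rw [Finset.mul_sum]
      refine Finset.sum_congr rfl fun b hb => ?_
      have hcb : c ≠ b := fun h => hc (h ▸ hb)
      rw [Finset.erase_insert_of_ne hcb, Finset.prod_insert (by simp [hc])]
      ring
    have h2 : ∏ i ∈ s, a i ≤ ∏ i ∈ s, (a i + d i) :=
      Finset.prod_le_prod (fun i _ => ha i) fun i _ => by linarith [hd i]
    rw [h1]
    nlinarith [mul_le_mul_of_nonneg_left h2 (hd c), mul_le_mul_of_nonneg_left ih (ha c)]

lemma load_cons {m n : ℕ} (b : Fin n) (ω : Fin m → Fin n) (i : Fin n) :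
    load (Fin.cons b ω : Fin (m + 1) → Fin n) i = load ω i + if i = b then 1 else 0 := by
  unfold load
  rw [Fin.card_filter_univ_succ]
  simp only [Fin.cons_zero, Fin.cons_succ, eq_comm (a := b)]
  split_ifs <;> simp

/-- The loads are negatively dependent. -/
theorem integral_prod_load_le {n : ℕ} [NeZero n] (m : ℕ) {f : Fin n → ℕ → ℝ}
    (hmono : ∀ i, Monotone (f i)) (hnn : ∀ i x, 0 ≤ f i x) :
    ∫ ω, ∏ i, f i (load ω i) ∂(ballsAndBins m n) ≤
      ∏ i, ∫ ω, f i (load ω i) ∂(ballsAndBins m n) := by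
  induction m generalizing f with
  | zero => simp [load]
  | succ m ih =>
    have hn : (0 : ℝ) < n := by exact_mod_cast NeZero.pos n
    set a : Fin n → ℝ := fun i => ∫ ω, f i (load ω i) ∂(ballsAndBins m n) with ha
    set d : Fin n → ℝ := fun i => ∫ ω, f i (load ω i + 1) ∂(ballsAndBins m n) - a i with hd
    have ha0 : ∀ i, 0 ≤ a i := fun i => integral_nonneg fun ω => hnn i _
    have hd0 : ∀ i, 0 ≤ d i := fun i => sub_nonneg.mpr <|
      integral_mono .of_finite .of_finite fun ω => hmono i (Nat.le_succ _)
    have hshift : ∀ b i, ∫ ω, f i (load ω i + if i = b then 1 else 0) ∂(ballsAndBins m n) =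
        a i + if i = b then d i else 0 := fun b i => by
      split_ifs <;> simp [hd, ha]
    have hR : ∀ i, ∫ ω, f i (load ω i) ∂(ballsAndBins (m + 1) n) = a i + (n : ℝ)⁻¹ * d i :=
        fun i => by
      rw [integral_ballsAndBins_succ]
      simp_rw [load_cons, hshift, Finset.sum_add_distrib]
      simp only [Finset.sum_const, Finset.card_univ, Fintype.card_fin, nsmul_eq_mul,
        Finset.sum_ite_eq, Finset.mem_univ, if_true]
      field_simp
    have hL : ∀ b, ∫ ω, ∏ i, f i (load (Fin.cons b ω : Fin (m + 1) → Fin n) i)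
        ∂(ballsAndBins m n) ≤ ∏ i, a i + d b * ∏ i ∈ Finset.univ.erase b, a i := fun b => by
      simp_rw [load_cons]
      -- Once the first ball is fixed in bin `b`, only the function of that bin is shifted; the
      -- induction therefore needs functions that vary with the bin.
      refine (ih (f := fun i x => f i (x + if i = b then 1 else 0))
        (fun i x y h => hmono i (by omega)) fun i x => hnn i _).trans_eq ?_
      simp_rw [hshift]
      rw [← Finset.mul_prod_erase _ _ (Finset.mem_univ b),
        ← Finset.mul_prod_erase _ a (Finset.mem_univ b), if_pos rfl]
      have : ∏ i ∈ Finset.univ.erase b, (a i + if i = b then d i else 0) =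
          ∏ i ∈ Finset.univ.erase b, a i :=
        Finset.prod_congr rfl fun i hi => by simp [Finset.ne_of_mem_erase hi]
      rw [this]
      ring
    rw [integral_ballsAndBins_succ]
    simp_rw [hR]
    refine le_trans ?_ (prod_add_sum_mul_prod_erase_le Finset.univ ha0
      fun i => mul_nonneg (inv_nonneg.mpr hn.le) (hd0 i))
    calc _ ≤ (n : ℝ)⁻¹ * ∑ b, (∏ i, a i + d b * ∏ i ∈ Finset.univ.erase b, a i) := by
          gcongr with b _
          exact hL b
      _ = _ := by
          rw [Finset.sum_add_distrib, mul_add, Finset.sum_const, Finset.card_univ,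
            Fintype.card_fin, nsmul_eq_mul, inv_mul_cancel_left₀ hn.ne', Finset.mul_sum]
          simp only [mul_assoc]

/-- Negative dependence for the increasing indicators of `x < load`, followed by `1 - p ≤ exp (-p)`
in each factor. -/
lemma measureReal_forall_load_gt_le {m n : ℕ} [NeZero n] (x : ℝ) {p : ℝ}
    (hp : ∀ i, p ≤ (ballsAndBins m n).real {ω | (load ω i : ℝ) ≤ x}) :
    (ballsAndBins m n).real {ω | ∀ i, x < load ω i} ≤ Real.exp (-(n * p)) := by
  classical
  have h := integral_prod_load_le m (f := fun (_ : Fin n) y => if x < (y : ℝ) then 1 else 0)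
    (fun _ y z hyz => by
      have : (y : ℝ) ≤ z := by exact_mod_cast hyz
      dsimp only
      split_ifs
      · rfl
      · linarith
      · exact zero_le_one
      · rfl)
    (fun _ y => by split_ifs <;> simp)
  have hprod : ∀ ω : Fin m → Fin n, ∏ i, (if x < (load ω i : ℝ) then (1 : ℝ) else 0) =
      if ∀ i, x < (load ω i : ℝ) then 1 else 0 := fun ω => by
    rw [Finset.prod_ite_zero]
    simp
  simp_rw [hprod, integral_ite_ballsAndBins] at h
  refine h.trans ?_
  have hi : ∀ i, (ballsAndBins m n).real {ω | x < (load ω i : ℝ)} ≤ Real.exp (-p) := fun i => by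
    have e : {ω : Fin m → Fin n | x < (load ω i : ℝ)} = {ω | (load ω i : ℝ) ≤ x}ᶜ := by
      ext ω; simp
    rw [e, probReal_compl_eq_one_sub (Set.toFinite _).measurableSet]
    linarith [hp i, Real.add_one_le_exp (-p)]
  refine (Finset.prod_le_prod (fun _ _ => measureReal_nonneg) fun i _ => hi i).trans_eq ?_
  rw [Finset.prod_const, ← Real.exp_nat_mul]
  simp

end negativeDependence

/-! ### Moderate deviations below the mean, by blocks of balls. -/

section lowerTail

/-- The probability that a set `S` of bins receives at least `x` fewer balls than expected. -/
noncomputable def lowerTail (m : ℕ) {n : ℕ} (S : Finset (Fin n)) (x : ℝ) : ℝ :=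
  (ballsAndBins m n).real {ω | (hits ω S : ℝ) ≤ m * (S.card / n) - x}

variable {n : ℕ} [NeZero n] (S : Finset (Fin n))

lemma lowerTail_nonneg (m : ℕ) (x : ℝ) : 0 ≤ lowerTail m S x := measureReal_nonneg

lemma hits_append {m₁ m₂ : ℕ} (ω₁ : Fin m₁ → Fin n) (ω₂ : Fin m₂ → Fin n) :
    hits (Fin.append ω₁ ω₂) S = hits ω₁ S + hits ω₂ S := by
  have : (hits (Fin.append ω₁ ω₂) S : ℝ) = hits ω₁ S + hits ω₂ S := by
    simp_rw [hits_eq_sum, Fin.sum_univ_add, Fin.append_left, Fin.append_right]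
  exact_mod_cast this

/-- Two disjoint blocks of balls are independent, and their shortfalls add. -/
lemma lowerTail_mul_le (m₁ m₂ : ℕ) (x y : ℝ) :
    lowerTail m₁ S x * lowerTail m₂ S y ≤ lowerTail (m₁ + m₂) S (x + y) := by
  classical
  unfold lowerTail
  simp_rw [← integral_ite_ballsAndBins]
  rw [integral_ballsAndBins_add, ← integral_mul_const]
  refine integral_mono .of_finite .of_finite fun ω₁ => ?_
  dsimp only
  rw [← integral_const_mul]
  refine integral_mono .of_finite .of_finite fun ω₂ => ?_
  simp only [hits_append]
  push_cast
  split_ifs <;> first | (exfalso; linarith) | norm_num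

lemma lowerTail_pow_le (m k : ℕ) (x : ℝ) :
    lowerTail m S x ^ k ≤ lowerTail (k * m) S (k * x) := by
  induction k with
  | zero =>
    rw [Nat.zero_mul]
    simp [lowerTail, hits]
  | succ k ih =>
    rw [pow_succ, Nat.succ_mul]
    push_cast
    rw [add_one_mul]
    exact (mul_le_mul_of_nonneg_right ih (lowerTail_nonneg S m x)).trans
      (lowerTail_mul_le S _ _ _ _)

/-- A first-moment bound: unless some ball hits `S`, the count is `0`, which is not above the mean.
It handles the balls left over after splitting into equal blocks. -/
lemma one_sub_le_lowerTail_zero (m : ℕ) : 1 - m * ((S.card : ℝ) / n) ≤ lowerTail m S 0 := by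
  have h : ∫ ω, (1 - (hits ω S : ℝ)) ∂(ballsAndBins m n) = 1 - m * ((S.card : ℝ) / n) := by
    rw [integral_sub .of_finite .of_finite, integral_hits]
    simp
  classical
  rw [← h, lowerTail, ← integral_ite_ballsAndBins]
  refine integral_mono .of_finite .of_finite fun ω => ?_
  dsimp only
  split_ifs with h1
  · linarith [Nat.cast_nonneg (α := ℝ) (hits ω S)]
  · have : hits ω S ≠ 0 := fun h0 => h1 (by rw [h0]; push_cast; rw [sub_zero]; positivity)
    have : (1 : ℝ) ≤ hits ω S := by exact_mod_cast Nat.one_le_iff_ne_zero.mpr this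
    linarith

lemma lowerTail_anti (m : ℕ) {x y : ℝ} (h : x ≤ y) : lowerTail m S y ≤ lowerTail m S x := by
  refine measureReal_mono fun ω hω => ?_
  simp only [Set.mem_ofPred_eq] at hω ⊢
  linarith

lemma lowerTail_congr {S T : Finset (Fin n)} (h : S.card = T.card) (m : ℕ) (x : ℝ) :
    lowerTail m S x = lowerTail m T x := by
  unfold lowerTail
  rw [h]
  exact measureReal_hits_congr h fun y => y ≤ m * (T.card / n) - x

/-- A lower bound for moderate deviations: split the balls into `k` blocks and let every block
deviate. -/
lemma lowerTail_ge (m k : ℕ) (hk : 1 ≤ k) (hm : k ≤ m) (i : Fin n) (hkn : 2 * k ≤ n) :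
    lowerTail (m / k) {i} (2 * √((m / k : ℕ) * (1 / n))) ^ k * (1 / 2) ≤
      lowerTail m {i} √(k * (m / n)) := by
  have hn : (0 : ℝ) < n := by exact_mod_cast NeZero.pos n
  set M := m / k with hM
  have hM1 : 1 ≤ M := (Nat.one_le_div_iff hk).mpr hm
  have hdecomp : k * M + m % k = m := Nat.div_add_mod m k
  have hr : m % k < k := Nat.mod_lt _ hk
  -- Fewer than `k ≤ n / 2` balls are left over, so they hit bin `i` at most `1 / 2` times on
  -- average.
  have hhalf : (1 : ℝ) / 2 ≤ lowerTail (m % k) {i} 0 := by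
    refine le_trans ?_ (one_sub_le_lowerTail_zero {i} (m % k))
    have h1 : ((m % k : ℕ) : ℝ) ≤ n / 2 := by
      rw [le_div_iff₀ two_pos]
      exact_mod_cast (by omega : m % k * 2 ≤ n)
    have h2 : ((m % k : ℕ) : ℝ) * (1 / n) ≤ n / 2 * (1 / n) := by gcongr
    have h3 : (n : ℝ) / 2 * (1 / n) = 1 / 2 := by field_simp
    simp only [Finset.card_singleton, Nat.cast_one]
    linarith
  have h1 := lowerTail_mul_le {i} (k * M) (m % k) (k * (2 * √(M * (1 / n)))) 0
  rw [hdecomp, add_zero] at h1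
  -- The factor `2` in the shortfall per block absorbs the rounding in `m / k`.
  have hdev : √(k * (m / n)) ≤ k * (2 * √(M * (1 / n))) := by
    rw [Real.sqrt_le_left (by positivity), mul_pow, mul_pow, Real.sq_sqrt (by positivity)]
    have h4 : (m : ℝ) ≤ 4 * k * M := by
      have : m ≤ 4 * k * M := by nlinarith
      exact_mod_cast this
    calc (k : ℝ) * (m / n) ≤ k * (4 * k * M / n) := by gcongr
      _ = _ := by ring
  calc _ ≤ lowerTail (k * M) {i} (k * (2 * √(M * (1 / n)))) * lowerTail (m % k) {i} 0 :=
        mul_le_mul (lowerTail_pow_le _ _ _ _) hhalf (by norm_num) (lowerTail_nonneg _ _ _)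
    _ ≤ lowerTail m {i} (k * (2 * √(M * (1 / n)))) := h1
    _ ≤ _ := lowerTail_anti _ _ hdev

end lowerTail

/-! ### The lightest bin. -/

section lightestBin

open ProbabilityTheory Topology

/-- With high probability the lightest bin is `√k` standard deviations below the mean, if
`k = o(log n)`. -/
theorem tendsto_measureReal_forall_load_gt {m k : ℕ → ℕ} (hk1 : ∀ᶠ j in atTop, 1 ≤ k j)
    (hk : Tendsto (fun j : ℕ => (k j : ℝ) / Real.log ((j + 1 : ℕ) : ℝ)) atTop (𝓝 0))
    (hm : Tendsto (fun j : ℕ => ((m j / k j : ℕ) : ℝ) * (1 / ((j + 1 : ℕ) : ℝ))) atTop atTop) :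
    Tendsto (fun j : ℕ => (ballsAndBins (m j) (j + 1)).real {ω | ∀ i,
      (m j : ℝ) / ((j + 1 : ℕ) : ℝ) - √(k j * (m j / ((j + 1 : ℕ) : ℝ))) < load ω i})
      atTop (𝓝 0) := by
  have hNinf : Tendsto (fun j : ℕ => ((j + 1 : ℕ) : ℝ)) atTop atTop :=
    tendsto_natCast_atTop_atTop.comp (tendsto_add_atTop_nat 1)
  set c : ℝ := (gaussianReal 0 1).real (Set.Iic (-2)) with hc
  have hcpos : 0 < c := gaussianReal_real_Iic_pos _
  have hclt := tendsto_measureReal_hits (N := fun j => j + 1) (M := fun j => m j / k j)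
    (fun j => {0}) (by
      simpa [Function.comp_def] using tendsto_inv_atTop_zero.comp hNinf)
    (by simpa only [Finset.card_singleton, Nat.cast_one] using hm)
    (measurableSet_Iic (a := (-2 : ℝ))) (by
      have : NullSingletonClass (gaussianReal 0 1) := nullSingletonClass_gaussianReal one_ne_zero
      rw [frontier_Iic]
      exact measure_singleton _)
  simp only [Finset.card_singleton, Nat.cast_one] at hclt
  have hblock : ∀ᶠ j : ℕ in atTop, c / 2 ≤ lowerTail (n := j + 1) (m j / k j) {0}
      (2 * √((m j / k j : ℕ) * (1 / ((j + 1 : ℕ) : ℝ)))) := by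
    filter_upwards [hclt.eventually_const_le (half_lt_self hcpos), hm.eventually_gt_atTop 0]
      with j hj hpos
    refine hj.trans (measureReal_mono fun ω hω => ?_)
    simp only [Set.mem_ofPred_eq, Set.mem_Iic, Finset.card_singleton, Nat.cast_one] at hω ⊢
    rw [div_le_iff₀ (Real.sqrt_pos.mpr hpos)] at hω
    linarith
  have hlog : ∀ᶠ j : ℕ in atTop, 0 < Real.log ((j + 1 : ℕ) : ℝ) :=
    (Real.tendsto_log_atTop.comp hNinf).eventually_gt_atTop 0
  have hkC : Tendsto (fun j : ℕ => (k j : ℝ) / Real.log ((j + 1 : ℕ) : ℝ) * -Real.log (c / 2))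
      atTop (𝓝 0) := by
    simpa using hk.mul_const (-Real.log (c / 2))
  -- Here `k = o(log n)` is used: a constant to the power `k` stays above `n ^ (-1 / 2)`.
  have hpow : ∀ᶠ j : ℕ in atTop, (Real.sqrt ((j + 1 : ℕ) : ℝ))⁻¹ ≤ (c / 2) ^ k j := by
    filter_upwards [hlog, hkC.eventually_le_const (one_half_pos)] with j hj hj2
    have hN : (0 : ℝ) < ((j + 1 : ℕ) : ℝ) := by positivity
    rw [div_mul_eq_mul_div, div_le_iff₀ hj] at hj2
    rw [← Real.log_le_log_iff (by positivity) (by positivity), Real.log_inv,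
      Real.log_sqrt hN.le, Real.log_pow]
    linarith
  have hsmall : ∀ᶠ j : ℕ in atTop, 2 * k j ≤ j + 1 := by
    filter_upwards [hlog, hk.eventually_le_const (one_half_pos)] with j hj hj2
    rw [div_le_iff₀ hj] at hj2
    have h := Real.log_le_self (x := ((j + 1 : ℕ) : ℝ)) (by positivity)
    have : (2 * k j : ℝ) ≤ ((j + 1 : ℕ) : ℝ) := by linarith
    exact_mod_cast this
  have hkm : ∀ᶠ j : ℕ in atTop, k j ≤ m j := by
    filter_upwards [hm.eventually_gt_atTop 0, hk1] with j hj hkj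
    by_contra h
    rw [Nat.div_eq_of_lt (not_le.mp h)] at hj
    simp at hj
  have hlim : Tendsto (fun j : ℕ => Real.exp (-(√((j + 1 : ℕ) : ℝ) / 2))) atTop (𝓝 0) := by
    refine Real.tendsto_exp_neg_atTop_nhds_zero.comp ?_
    exact (Real.tendsto_sqrt_atTop.comp hNinf).atTop_div_const two_pos
  refine squeeze_zero' (.of_forall fun _ => measureReal_nonneg) ?_ hlim
  filter_upwards [hblock, hpow, hsmall, hkm, hk1] with j h1 h2 h3 h4 h5
  have hN : (0 : ℝ) < ((j + 1 : ℕ) : ℝ) := by positivity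
  -- With this `p`, the exponent `n * p` is `√n / 2`.
  refine (measureReal_forall_load_gt_le _ (p := (√((j + 1 : ℕ) : ℝ))⁻¹ * (1 / 2))
    fun i => ?_).trans_eq ?_
  · have h6 := lowerTail_ge (n := j + 1) (m j) (k j) h5 h4 i h3
    rw [lowerTail_congr (S := {i}) (T := {0}) (by simp)] at h6
    have h7 : lowerTail (n := j + 1) (m j) {i} √(k j * (m j / ((j + 1 : ℕ) : ℝ))) =
        (ballsAndBins (m j) (j + 1)).real {ω | (load ω i : ℝ) ≤
          (m j : ℝ) / ((j + 1 : ℕ) : ℝ) - √(k j * (m j / ((j + 1 : ℕ) : ℝ)))} := by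
      simp only [lowerTail, hits_singleton, Finset.card_singleton, Nat.cast_one, mul_one_div]
    rw [← h7]
    refine le_trans ?_ h6
    gcongr
    exact h2.trans (by gcongr)
  · congr 2
    have : ((j + 1 : ℕ) : ℝ) = √((j + 1 : ℕ) : ℝ) * √((j + 1 : ℕ) : ℝ) :=
      (Real.mul_self_sqrt hN.le).symm
    have hs : √((j + 1 : ℕ) : ℝ) ≠ 0 := (Real.sqrt_pos.mpr hN).ne'
    conv_lhs => rw [this]
    rw [Real.sqrt_mul_self (Real.sqrt_nonneg _)]
    field_simp

end lightestBin

/-! ### From a fixed allocation to the expected Shapley value. -/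

section expectation

variable {m n : ℕ} [NeZero n]

/-- Sorting only relabels the agents, so one may work with the unsorted, exchangeable loads and let
the agent be random instead. -/
lemma shapley_sortedWeight (ω : Fin m → Fin n) (q : ℝ) (i : Fin n) :
    shapley (sortedWeight ω) q i =
      shapley (fun j => (load ω j : ℝ)) q (Tuple.sort (load ω) i) :=
  shapley_comp_perm (w := fun j => (load ω j : ℝ)) (Tuple.sort (load ω)) i

lemma load_sort_zero_le (ω : Fin m → Fin n) (hn : 0 < n) (i : Fin n) :
    load ω (Tuple.sort (load ω) ⟨0, hn⟩) ≤ load ω i := by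
  have h := Tuple.monotone_sort (load ω)
    (show (⟨0, hn⟩ : Fin n) ≤ (Tuple.sort (load ω)).symm i from Nat.zero_le _)
  simpa using h

-- A pointwise bound in which each unlikely event enters through its indicator, so that integration
-- yields probabilities. The two averages no longer involve the random lightest agent.
open Classical in
lemma abs_mul_shapley_sortedWeight_sub_le (ω : Fin m → Fin n) (hn : 0 < n) {ℓ : ℕ} (hℓ : 1 ≤ ℓ)
    (hℓn : ℓ < n) (a : ℝ) {c : ℝ} (hc : 0 < c) (hcm : (ℓ + 1) * c ≤ (m : ℝ) / n) :
    |n * shapley (sortedWeight ω) (ℓ * ((m : ℝ) / n)) ⟨0, hn⟩ -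
      permAvg fun σ => if (hits ω (initial σ ℓ) : ℝ) < ℓ * ((m : ℝ) / n) then 1 else 0| ≤
      2 * ℓ / n + (permAvg fun σ =>
        if (ℓ - 1) * ((m : ℝ) / n) + a ≤ hits ω (initial σ (ℓ - 1)) then 1 else 0) +
      (if ∀ i, (m : ℝ) / n - a < load ω i then 1 else 0) +
      2 * n * (if ∃ i, c ≤ |(load ω i : ℝ) - m / n| then 1 else 0) := by
  rw [shapley_sortedWeight]
  set w : Fin n → ℝ := fun j => (load ω j : ℝ) with hw
  set i := Tuple.sort (load ω) ⟨0, hn⟩ with hi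
  set q : ℝ := ℓ * ((m : ℝ) / n) with hq
  have hn1 : (1 : ℝ) ≤ n := by exact_mod_cast hn
  have hl1 : (1 : ℝ) ≤ ℓ := by exact_mod_cast hℓ
  have hB0 : 0 ≤ permAvg fun σ : Equiv.Perm (Fin n) =>
      if (hits ω (initial σ ℓ) : ℝ) < q then (1 : ℝ) else 0 :=
    permAvg_nonneg fun σ => by split_ifs <;> simp
  have hB1 : (permAvg fun σ : Equiv.Perm (Fin n) =>
      if (hits ω (initial σ ℓ) : ℝ) < q then (1 : ℝ) else 0) ≤ 1 :=
    permAvg_le_one fun σ => by split_ifs <;> simp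
  have hD0 : 0 ≤ permAvg fun σ : Equiv.Perm (Fin n) =>
      if (ℓ - 1) * ((m : ℝ) / n) + a ≤ hits ω (initial σ (ℓ - 1)) then (1 : ℝ) else 0 :=
    permAvg_nonneg fun σ => by split_ifs <;> simp
  have hH0 : (0 : ℝ) ≤ if ∀ i, (m : ℝ) / n - a < load ω i then 1 else 0 := by
    split_ifs <;> simp
  have hl0 : (0 : ℝ) ≤ 2 * ℓ / n := by positivity
  -- If some load is atypical, the trivial bounds `n` and `1` suffice, since `n + 1 ≤ 2 * n`.
  by_cases hG : ∃ i, c ≤ |(load ω i : ℝ) - m / n|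
  · rw [if_pos hG]
    have h0 : 0 ≤ n * shapley w q i :=
      mul_nonneg (by positivity) (shapley_nonneg (Nat.cast_nonneg _))
    have h1 : n * shapley w q i ≤ n * 1 :=
      mul_le_mul_of_nonneg_left (shapley_le_one i) (by positivity)
    rw [abs_le]
    constructor <;> linarith
  · rw [if_neg hG, mul_zero, add_zero]
    push Not at hG
    have hlow : ∀ j, (m : ℝ) / n - c ≤ w j := fun j => by
      have := (abs_lt.mp (hG j)).1; simp only [hw]; linarith
    have hupp : ∀ j, w j ≤ (m : ℝ) / n + c := fun j => by
      have := (abs_lt.mp (hG j)).2; simp only [hw]; linarith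
    have hcm' : 0 ≤ (m : ℝ) / n - c := by nlinarith
    -- `(ℓ + 1) * c ≤ m / n` is exactly what `ℓ + 1` minimally loaded agents need to reach `q`; it
    -- also keeps `ℓ - 1` maximally loaded ones below `q`.
    have key := abs_mul_shapley_sub_le (w := w) (q := q) hℓ hℓn
      (fun S hS => by
        refine (Finset.sum_le_card_nsmul _ _ _ fun j _ => hupp j).trans_lt ?_
        have h1 : (S.card : ℝ) ≤ ℓ - 1 := by
          have : (S.card : ℝ) + 1 ≤ ℓ := by exact_mod_cast hS
          linarith
        have h2 : (S.card : ℝ) * ((m : ℝ) / n + c) ≤ (ℓ - 1) * ((m : ℝ) / n + c) :=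
          mul_le_mul_of_nonneg_right h1 (by positivity)
        rw [nsmul_eq_mul, hq]
        linarith)
      (fun S hS => by
        refine le_trans ?_ (Finset.card_nsmul_le_sum _ _ _ fun j _ => hlow j)
        have h1 : (ℓ : ℝ) + 1 ≤ S.card := by exact_mod_cast hS
        have h2 : ((ℓ : ℝ) + 1) * ((m : ℝ) / n - c) ≤ S.card * ((m : ℝ) / n - c) :=
          mul_le_mul_of_nonneg_right h1 hcm'
        rw [nsmul_eq_mul, hq]
        linarith) i
    simp only [hw, sum_load_cast] at key
    refine key.trans ?_
    rw [add_assoc]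
    refine add_le_add le_rfl ?_
    by_cases hH : ∀ i, (m : ℝ) / n - a < load ω i
    · rw [if_pos hH]
      refine le_trans (permAvg_le_one fun σ => ?_) (le_add_of_nonneg_left hD0)
      split_ifs <;> simp
    · rw [if_neg hH, add_zero]
      push Not at hH
      obtain ⟨j, hj⟩ := hH
      have hij : (load ω i : ℝ) ≤ load ω j := by exact_mod_cast load_sort_zero_le ω hn j
      refine permAvg_mono fun σ => ?_
      split_ifs with h1 h2
      · rfl
      · exact absurd (by rw [hq] at h1; linarith) h2
      · exact zero_le_one
      · rfl

-- For each order the first `k` bins form a set of fixed size, so after exchanging average and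
-- integral all orders contribute equally.
open Classical in
lemma integral_permAvg_hits {k : ℕ} (hk : k ≤ n) (P : ℝ → Prop) {S : Finset (Fin n)}
    (hS : S.card = k) :
    ∫ ω, (permAvg fun σ : Equiv.Perm (Fin n) => if P (hits ω (initial σ k)) then (1 : ℝ) else 0)
      ∂(ballsAndBins m n) = (ballsAndBins m n).real {ω | P (hits ω S)} := by
  simp only [permAvg]
  rw [integral_const_mul, integral_finsetSum _ fun _ _ => .of_finite]
  simp_rw [integral_ite_ballsAndBins fun ω : Fin m → Fin n => P (hits ω (initial _ k)),
    measureReal_hits_congr ((card_initial _ hk).trans hS.symm) P]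
  exact permAvg_const _

theorem abs_mul_expectedMinShapley_sub_le (hn : 0 < n) {ℓ : ℕ} (hℓ : 1 ≤ ℓ)
    (hℓn : ℓ < n) {a : ℝ} (ha : 0 < a) (hm : 0 < m) {S : Finset (Fin n)} (hS : S.card = ℓ) :
    |n * expectedMinShapley n m (ℓ * ((m : ℝ) / n)) -
      (ballsAndBins m n).real {ω | (hits ω S : ℝ) < ℓ * ((m : ℝ) / n)}| ≤
      2 * ℓ / n + ℓ * ((m : ℝ) / n) / a ^ 2 +
      (ballsAndBins m n).real {ω | ∀ i, (m : ℝ) / n - a < load ω i} +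
      4 * n ^ 2 * Real.exp (-(2 * m / (n ^ 2 * (ℓ + 1) ^ 2))) := by
  classical
  have hn0 : (0 : ℝ) < n := by exact_mod_cast hn
  have hm0 : (0 : ℝ) < m := by exact_mod_cast hm
  set c : ℝ := (m : ℝ) / n / (ℓ + 1) with hc
  have hcpos : 0 < c := by positivity
  -- `c` is the largest deviation that the pivotality argument allows.
  have hcm : ((ℓ : ℝ) + 1) * c ≤ (m : ℝ) / n := by rw [hc]; field_simp; rfl
  obtain ⟨T, -, hT⟩ := Finset.exists_subset_card_eq (s := S) (n := ℓ - 1) (by omega)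
  have hTc : ((T.card : ℕ) : ℝ) = ℓ - 1 := by rw [hT, Nat.cast_sub hℓ, Nat.cast_one]
  have hpt := fun ω : Fin m → Fin n =>
    abs_mul_shapley_sortedWeight_sub_le ω hn hℓ hℓn a hcpos hcm
  have hint := (abs_integral_le_integral_abs (μ := ballsAndBins m n)).trans
    (integral_mono .of_finite .of_finite hpt)
  rw [integral_sub .of_finite .of_finite, integral_const_mul,
    integral_permAvg_hits hℓn.le (fun x => x < ℓ * ((m : ℝ) / n)) hS,
    integral_add .of_finite .of_finite, integral_add .of_finite .of_finite,
    integral_add .of_finite .of_finite, integral_const_mul,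
    integral_permAvg_hits (by omega) (fun x => (ℓ - 1) * ((m : ℝ) / n) + a ≤ x) hT,
    integral_ite_ballsAndBins, integral_ite_ballsAndBins, integral_const, probReal_univ,
    one_smul] at hint
  rw [expectedMinShapley, dif_pos hn]
  refine hint.trans ?_
  have h1 : (ballsAndBins m n).real {ω | (ℓ - 1) * ((m : ℝ) / n) + a ≤ hits ω T} ≤
      ℓ * ((m : ℝ) / n) / a ^ 2 := by
    have := measureReal_hits_ge_le (m := m) (S := T) ha
    rw [hTc, mul_div_left_comm] at this
    refine this.trans ?_
    gcongr
    linarith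
  have h2 : 2 * n * (ballsAndBins m n).real {ω | ∃ i, c ≤ |(load ω i : ℝ) - m / n|} ≤
      4 * n ^ 2 * Real.exp (-(2 * m / (n ^ 2 * (ℓ + 1) ^ 2))) := by
    have := measureReal_exists_abs_load_sub_ge_le (m := m) (n := n) hcpos.le
    have e : 2 * c ^ 2 / m = 2 * m / (n ^ 2 * (ℓ + 1) ^ 2) := by
      rw [hc]; field_simp
    rw [e] at this
    calc _ ≤ 2 * n * (2 * n * Real.exp (-(2 * m / ((n : ℝ) ^ 2 * (ℓ + 1) ^ 2)))) := by gcongr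
      _ = _ := by ring
  linarith

end expectation

/-! ### Choice of `k` and vanishing of the error terms. -/

section asymptotics

open ProbabilityTheory Topology

/-- For `j + 1` agents, the expected Shapley value of the lightest one, multiplied by the number of
agents, tends to `1 / 2`. -/
theorem tendsto_mul_expectedMinShapley {ℓ m : ℕ → ℕ} (hℓ1 : ∀ᶠ j in atTop, 1 ≤ ℓ j)
    (hℓ : Tendsto (fun j : ℕ => (ℓ j : ℝ) / Real.log ((j + 1 : ℕ) : ℝ)) atTop (𝓝 0))
    {C : ℝ} (hC : 0 < C)
    (hm : ∀ᶠ j : ℕ in atTop,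
      C * (((j + 1 : ℕ) : ℝ) ^ 3 * Real.log ((j + 1 : ℕ) : ℝ)) ≤ m j) :
    Tendsto (fun j : ℕ => ((j + 1 : ℕ) : ℝ) *
      expectedMinShapley (j + 1) (m j) (ℓ j * ((m j : ℝ) / ((j + 1 : ℕ) : ℝ))))
      atTop (𝓝 (1 / 2)) := by
  set N : ℕ → ℝ := fun j => ((j + 1 : ℕ) : ℝ) with hN
  set L : ℕ → ℝ := fun j => Real.log (N j) with hL
  have hNpos : ∀ j, 0 < N j := fun j => by positivity
  have hNinf : Tendsto N atTop atTop :=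
    tendsto_natCast_atTop_atTop.comp (tendsto_add_atTop_nat 1)
  have hLinf : Tendsto L atTop atTop := Real.tendsto_log_atTop.comp hNinf
  have hL1 : ∀ᶠ j in atTop, 2 ≤ L j := hLinf.eventually_ge_atTop 2
  have hLN : ∀ j, L j ≤ N j := fun j => Real.log_le_self (hNpos j).le
  -- Essentially the geometric mean of `ℓ` and `log n`, so that both `ℓ / k` and `k / log n` tend to
  -- `0`.
  set k : ℕ → ℕ := fun j => ⌈√(ℓ j * L j)⌉₊ with hk
  have hsqrt : Tendsto (fun j => √(ℓ j / L j)) atTop (𝓝 0) := by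
    have h := (Real.continuous_sqrt.tendsto 0).comp hℓ
    rwa [Real.sqrt_zero] at h
  have hℓL : ∀ᶠ j in atTop, (ℓ j : ℝ) + 1 ≤ L j := by
    filter_upwards [hL1, hℓ.eventually_le_const one_half_pos] with j h1 h2
    rw [div_le_iff₀ (by linarith)] at h2
    linarith
  have hℓk : ∀ᶠ j in atTop, √(ℓ j * L j) ≤ k j := .of_forall fun j => Nat.le_ceil _
  have hkpos : ∀ᶠ j in atTop, 1 ≤ k j := by
    filter_upwards [hL1, hℓ1] with j h1 h2
    have : (1 : ℝ) ≤ ℓ j := by exact_mod_cast h2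
    exact Nat.one_le_ceil_iff.mpr (Real.sqrt_pos.mpr (by positivity))
  have hkL : Tendsto (fun j => (k j : ℝ) / L j) atTop (𝓝 0) := by
    have hlim : Tendsto (fun j => √(ℓ j / L j) + (L j)⁻¹) atTop (𝓝 0) := by
      simpa using hsqrt.add (tendsto_inv_atTop_zero.comp hLinf)
    refine squeeze_zero' ?_ ?_ hlim
    · filter_upwards [hL1] with j h1
      positivity
    · filter_upwards [hL1] with j h1
      have hLp : 0 < L j := by linarith
      have h2 : (k j : ℝ) ≤ √(ℓ j * L j) + 1 := (Nat.ceil_lt_add_one (Real.sqrt_nonneg _)).le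
      have h3 : √(ℓ j * L j) / L j = √(ℓ j / L j) := by
        rw [Real.sqrt_mul (Nat.cast_nonneg _), Real.sqrt_div (Nat.cast_nonneg _), mul_div_assoc,
          Real.sqrt_div_self', mul_one_div]
      rw [div_le_iff₀ hLp, add_mul, inv_mul_cancel₀ hLp.ne', ← h3, div_mul_cancel₀ _ hLp.ne']
      exact h2
  have hkL1 : ∀ᶠ j in atTop, (k j : ℝ) ≤ L j := by
    filter_upwards [hL1, hkL.eventually_le_const one_pos] with j h1 h2
    rwa [div_le_one (by linarith)] at h2
  have hℓdivk : Tendsto (fun j => (ℓ j : ℝ) / k j) atTop (𝓝 0) := by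
    refine squeeze_zero' (.of_forall fun j => by positivity) ?_ hsqrt
    filter_upwards [hL1, hℓk, hkpos] with j h1 h2 h3
    have hLp : 0 < L j := by linarith
    have hkp : (0 : ℝ) < k j := by exact_mod_cast h3
    rw [div_le_iff₀ hkp]
    calc (ℓ j : ℝ) = √(ℓ j / L j) * √(ℓ j * L j) := by
          rw [← Real.sqrt_mul (by positivity)]
          have : (ℓ j : ℝ) / L j * (ℓ j * L j) = ℓ j ^ 2 := by field_simp
          rw [this, Real.sqrt_sq (Nat.cast_nonneg _)]
      _ ≤ _ := by gcongr
  have hmpos : ∀ᶠ j in atTop, 0 < m j := by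
    filter_upwards [hm, hL1] with j h1 h2
    have : (0 : ℝ) < m j := lt_of_lt_of_le (by have := hNpos j; positivity) h1
    exact_mod_cast this
  have hblock : Tendsto (fun j => ((m j / k j : ℕ) : ℝ) * (1 / N j)) atTop atTop := by
    have hlim : Tendsto (fun j => C * N j + (-1)) atTop atTop :=
      tendsto_atTop_add_const_right _ _ (hNinf.const_mul_atTop hC)
    refine tendsto_atTop_mono' _ ?_ hlim
    filter_upwards [hm, hL1, hkL1, hkpos] with j h1 h2 h3 h4
    have hkp : (0 : ℝ) < k j := by exact_mod_cast h4
    have hNj := hNpos j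
    have hN1 : 1 ≤ N j := by simp [hN]
    have h5 : (m j : ℝ) / k j ≤ ((m j / k j : ℕ) : ℝ) + 1 := by
      rw [div_le_iff₀ hkp]
      have := Nat.lt_div_mul_add (a := m j) (b := k j) (by omega)
      have h6 : m j ≤ (m j / k j + 1) * k j := by rw [add_one_mul]; exact this.le
      exact_mod_cast h6
    have h6 : C * N j ^ 3 ≤ (m j : ℝ) / k j := by
      rw [le_div_iff₀ hkp]
      refine le_trans ?_ h1
      rw [mul_assoc]
      gcongr
    rw [mul_one_div, le_div_iff₀ hNj]
    have h7 : C * N j * N j ≤ C * N j ^ 3 := by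
      rw [mul_assoc]
      gcongr
      nlinarith
    linarith
  have hmN : ∀ᶠ j in atTop, C * N j ≤ (m j : ℝ) / N j := by
    filter_upwards [hm, hL1] with j h1 h2
    have hNj := hNpos j
    have hN1 : 1 ≤ N j := by simp [hN]
    rw [le_div_iff₀ hNj]
    refine le_trans ?_ h1
    rw [mul_assoc]
    refine mul_le_mul_of_nonneg_left ?_ hC.le
    calc N j * N j = N j ^ 2 * 1 := by ring
      _ ≤ N j ^ 3 * L j := by
        gcongr
        · norm_num
        · linarith
  have hℓN : ∀ᶠ j in atTop, ℓ j < j + 1 := by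
    filter_upwards [hℓL] with j h1
    have : (ℓ j : ℝ) < N j := by linarith [hLN j]
    exact Nat.cast_lt.mp this
  have hcard : ∀ᶠ j in atTop, (initial (1 : Equiv.Perm (Fin (j + 1))) (ℓ j)).card = ℓ j := by
    filter_upwards [hℓN] with j h1
    exact card_initial _ h1.le
  have hℓdivN : Tendsto (fun j => (ℓ j : ℝ) / N j) atTop (𝓝 0) := by
    refine squeeze_zero' (.of_forall fun j => by positivity) ?_ hℓ
    filter_upwards [hL1] with j h1
    exact div_le_div_of_nonneg_left (Nat.cast_nonneg _) (by linarith) (hLN j)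
  have hmean : Tendsto (fun j => (m j : ℝ) * (ℓ j / N j)) atTop atTop := by
    refine tendsto_atTop_mono' _ ?_ (hNinf.const_mul_atTop hC)
    filter_upwards [hmN, hℓ1] with j h1 h2
    have : (1 : ℝ) ≤ ℓ j := by exact_mod_cast h2
    have hNj := hNpos j
    calc C * N j ≤ m j * (1 / N j) := by rwa [mul_one_div]
      _ ≤ _ := by gcongr
  have hhalf : Tendsto (fun j => (ballsAndBins (m j) (j + 1)).real
      {ω | (hits ω (initial (1 : Equiv.Perm (Fin (j + 1))) (ℓ j)) : ℝ) < ℓ j * (m j / N j)})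
      atTop (𝓝 (1 / 2)) := by
    have hclt := tendsto_measureReal_hits (N := fun j => j + 1) (M := m)
      (fun j => initial (1 : Equiv.Perm (Fin (j + 1))) (ℓ j))
      (hℓdivN.congr' (by filter_upwards [hcard] with j h1; rw [h1]))
      (hmean.congr' (by filter_upwards [hcard] with j h1; rw [h1]))
      (measurableSet_Iio (a := (0 : ℝ))) (by
        have : NullSingletonClass (gaussianReal 0 1) := nullSingletonClass_gaussianReal one_ne_zero
        rw [frontier_Iio]
        exact measure_singleton _)
    rw [gaussianReal_real_Iio_zero] at hclt
    refine hclt.congr' ?_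
    filter_upwards [hcard, hmean.eventually_gt_atTop 0] with j h1 h2
    congr 1
    ext ω
    simp only [Set.mem_ofPred_eq, Set.mem_Iio]
    rw [h1, div_lt_iff₀ (Real.sqrt_pos.mpr h2), zero_mul, sub_neg, mul_div_left_comm]
  -- The cubic growth of `m` matters here: with `ℓ + 1 ≤ L`, the exponent is at least `2 * C * N / L
  -- ≥ √N`, which beats the factor `N ^ 2`.
  have hexp : Tendsto (fun j => 4 * N j ^ 2 *
      Real.exp (-(2 * m j / (N j ^ 2 * (ℓ j + 1) ^ 2)))) atTop (𝓝 0) := by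
    have hlim : Tendsto (fun j => 4 * (√(N j) ^ 4 * Real.exp (-√(N j)))) atTop (𝓝 0) := by
      simpa using ((Real.tendsto_pow_mul_exp_neg_atTop_nhds_zero 4).comp
        (Real.tendsto_sqrt_atTop.comp hNinf)).const_mul 4
    have hlogsqrt : ∀ᶠ j in atTop, L j ≤ 2 * C * √(N j) := by
      have h := ((isLittleO_log_rpow_atTop (one_half_pos (α := ℝ))).comp_tendsto hNinf).def
        (show 0 < 2 * C by positivity)
      filter_upwards [h, hL1] with j h1 h2
      simp only [Function.comp, ← Real.sqrt_eq_rpow] at h1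
      rwa [Real.norm_of_nonneg (by linarith : 0 ≤ Real.log (N j)),
        Real.norm_of_nonneg (Real.sqrt_nonneg _)] at h1
    refine squeeze_zero' (.of_forall fun j => by have := hNpos j; positivity) ?_ hlim
    filter_upwards [hm, hL1, hℓL, hlogsqrt] with j h1 h2 h3 h4
    have hNj := hNpos j
    have e4 : √(N j) ^ 4 = N j ^ 2 := by
      rw [show (4 : ℕ) = 2 * 2 from rfl, pow_mul, Real.sq_sqrt hNj.le]
    rw [e4, ← mul_assoc]
    gcongr
    rw [le_div_iff₀ (by positivity)]
    have hs : √(N j) * √(N j) = N j := Real.mul_self_sqrt hNj.le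
    calc √(N j) * (N j ^ 2 * (ℓ j + 1) ^ 2) ≤ √(N j) * (N j ^ 2 * L j ^ 2) := by gcongr
      _ = √(N j) * N j ^ 2 * L j * L j := by ring
      _ ≤ √(N j) * N j ^ 2 * L j * (2 * C * √(N j)) := by gcongr
      _ = 2 * (C * ((√(N j) * √(N j)) * N j ^ 2 * L j)) := by ring
      _ = 2 * (C * (N j ^ 3 * L j)) := by rw [hs]; ring
      _ ≤ 2 * m j := by gcongr
  have hmin := tendsto_measureReal_forall_load_gt hkpos hkL hblock
  have herr : Tendsto (fun j => 2 * (ℓ j / N j) + ℓ j / k j +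
      (ballsAndBins (m j) (j + 1)).real
        {ω | ∀ i, (m j : ℝ) / N j - √(k j * (m j / N j)) < load ω i} +
      4 * N j ^ 2 * Real.exp (-(2 * m j / (N j ^ 2 * (ℓ j + 1) ^ 2)))) atTop (𝓝 0) := by
    have h := (((hℓdivN.const_mul 2).add hℓdivk).add hmin).add hexp
    simp only [mul_zero, add_zero] at h
    exact h
  have hdiff : Tendsto (fun j => N j *
      expectedMinShapley (j + 1) (m j) (ℓ j * ((m j : ℝ) / N j)) -
      (ballsAndBins (m j) (j + 1)).real
      {ω | (hits ω (initial (1 : Equiv.Perm (Fin (j + 1))) (ℓ j)) : ℝ) < ℓ j * (m j / N j)})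
      atTop (𝓝 0) := by
    rw [tendsto_zero_iff_abs_tendsto_zero]
    refine squeeze_zero' (.of_forall fun j => abs_nonneg _) ?_ herr
    filter_upwards [hcard, hℓ1, hℓN, hkpos, hmpos] with j h1 h2 h3 h4 h5
    have hkp : (0 : ℝ) < k j := by exact_mod_cast h4
    have hmp : (0 : ℝ) < m j := by exact_mod_cast h5
    have hNj := hNpos j
    -- With `a ^ 2 = k * m / N`, the Chebyshev term becomes `ℓ / k`.
    refine (abs_mul_expectedMinShapley_sub_le (n := j + 1) (Nat.succ_pos j) h2 h3
      (a := √(k j * (m j / N j))) (Real.sqrt_pos.mpr (by positivity)) h5 h1).trans_eq ?_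
    rw [Real.sq_sqrt (by positivity)]
    have e : (ℓ j : ℝ) * (m j / N j) / (k j * (m j / N j)) = ℓ j / k j := by
      rw [mul_div_mul_right _ _ (by positivity)]
    change 2 * (ℓ j : ℝ) / N j + ℓ j * (m j / N j) / (k j * (m j / N j)) + _ + _ = _
    rw [e, mul_div_assoc]
  have h := hdiff.add hhalf
  simp only [sub_add_cancel, zero_add] at h
  exact h

end asymptotics

end VotingGame

theorem mainTheorem3 (ℓ m : ℕ → ℕ)
    (hℓ_pos : ∀ᶠ n in atTop, 1 ≤ ℓ n)
    (hℓ : (fun n : ℕ => (ℓ n : ℝ)) =o[atTop] (fun n : ℕ => Real.log n))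
    (hm : (fun n : ℕ => (n : ℝ) ^ 3 * Real.log n) =O[atTop] (fun n : ℕ => (m n : ℝ))) :
    (fun n : ℕ =>
        VotingGame.expectedMinShapley n (m n) ((ℓ n : ℝ) * ((m n : ℝ) / (n : ℝ))) -
          1 / (2 * (n : ℝ)))
      =o[atTop] (fun n : ℕ => 1 / (n : ℝ)) := by
  -- Indexing by `n = j + 1` makes every set of bins nonempty; the value at `n = 0` plays no role in
  -- the limit.
  have hshift := tendsto_add_atTop_nat 1
  obtain ⟨c, hc, hcm⟩ := hm.exists_pos
  have key := VotingGame.tendsto_mul_expectedMinShapley (ℓ := fun j => ℓ (j + 1))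
    (m := fun j => m (j + 1)) (hshift.eventually hℓ_pos)
    (hℓ.tendsto_div_nhds_zero.comp hshift) (inv_pos.mpr hc) (by
      filter_upwards [hshift.eventually hcm.bound] with j hj
      rw [Real.norm_of_nonneg (mul_nonneg (by positivity) (Real.log_natCast_nonneg _)),
        Real.norm_of_nonneg (Nat.cast_nonneg _)] at hj
      rwa [inv_mul_le_iff₀ hc])
  have key' : Tendsto (fun n : ℕ => (n : ℝ) *
      VotingGame.expectedMinShapley n (m n) ((ℓ n : ℝ) * ((m n : ℝ) / (n : ℝ)))) atTop
      (nhds (1 / 2)) := (tendsto_add_atTop_iff_nat 1).mp key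
  have hpos : ∀ᶠ n : ℕ in atTop, 0 < n := eventually_gt_atTop 0
  rw [isLittleO_iff_tendsto' (by
    filter_upwards [hpos] with n hn h0
    have : (n : ℝ) ≠ 0 := by exact_mod_cast hn.ne'
    simp [this] at h0)]
  have h := key'.sub_const (1 / 2)
  rw [sub_self] at h
  refine h.congr' ?_
  filter_upwards [hpos] with n hn
  have : (n : ℝ) ≠ 0 := by exact_mod_cast hn.ne'
  field_simp
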